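/- Let $dA$ and $|\cdot|$ denote Lebesgue measure on $\mathbb{C}$, and let $\mathcal{F}$ be the Fock space of entire functions $F$ with $\|F\|^2=\int_{\mathbb{C}}|F(z)|^2e^{-\pi|z|^2}\,dA(z)<\infty$, with the corresponding inner product. Let $w\in\mathbb{C}$ and let $\Omega\subset\mathbb{C}$ have circular symmetry around $w$, i.e. $\Omega=\{z\in\mathbb{C}:|z-w|\in E\}$ for some measurable $E\subset[0,\infty)$, and suppose that $0<|\Omega|<\infty$. Let $n\ge 1$ be an integer and let $F_1,\dots,F_n$ be orthonormal in $\mathcal{F}$. Then $$\sum_{k=1}^{n}\int_\Omega |F_k(z)|^2e^{-\pi|z|^2}\,dA(z)\;\le\; n-\sum_{k=0}^{n-1}(n-k)\frac{|\Omega|^k}{k!}e^{-|\Omega|}.$$ Moreover, equality holds if and only if $\Omega$ coincides, up to a set of measure zero, with a ball centered at $w$ and there is a unitary matrix $U\in\mathbb{C}^{n\times n}$ such that $$\begin{pmatrix}F_1(z)\\ \vdots\\ F_n(z)\end{pmatrix}=U\begin{pmatrix}\mathcal{U}_we_0(z)\\ \vdots\\ \mathcal{U}_we_{n-1}(z)\end{pmatrix}\qquad\text{for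 all } z\in\mathbb{C},$$ where $e_k(z)=\pi^{k/2}z^k/\sqrt{k!}$ and $\mathcal{U}_w:\mathcal{F}\to\mathcal{F}$ is the unitary operator $\mathcal{U}_wF(z)=e^{-\pi|w|^2/2+\pi z\overline{w}}F(z-w)$. -/

import Mathlib

open MeasureTheory
open scoped ComplexConjugate Matrix

/-- The Gaussian weight `e^{-π|z|²}` on the complex plane. -/
noncomputable def fockWeight (z : ℂ) : ℝ := Real.exp (-(Real.pi * ‖z‖ ^ 2))

theorem fockWeight_pos (z : ℂ) : 0 < fockWeight z := Real.exp_pos _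

theorem continuous_fockWeight : Continuous fockWeight := by
  unfold fockWeight; fun_prop

/-- The entire functions `F` with `∫_ℂ |F(z)|² e^{-π|z|²} dA(z) < ∞`,
as a complex vector space. -/
noncomputable def fockSubmodule : Submodule ℂ (ℂ → ℂ) where
  carrier := {F | Differentiable ℂ F ∧ Integrable (fun z => ‖F z‖ ^ 2 * fockWeight z)}
  zero_mem' := ⟨differentiable_const 0, by simp⟩
  add_mem' := by
    rintro F G ⟨hF, hF'⟩ ⟨hG, hG'⟩
    refine ⟨hF.add hG, ((hF'.const_mul 2).add (hG'.const_mul 2)).mono' ?_ (.of_forall fun z => ?_)⟩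
    · exact (((hF.add hG).continuous.norm.pow 2).mul continuous_fockWeight).aestronglyMeasurable
    · have hw := (fockWeight_pos z).le
      rw [Real.norm_of_nonneg (by positivity)]
      simp only [Pi.add_apply]
      have h1 : ‖F z + G z‖ ^ 2 ≤ 2 * ‖F z‖ ^ 2 + 2 * ‖G z‖ ^ 2 := by
        nlinarith [norm_add_le (F z) (G z), norm_nonneg (F z + G z), sq_nonneg (‖F z‖ - ‖G z‖)]
      nlinarith [mul_le_mul_of_nonneg_right h1 hw]
  smul_mem' := by
    rintro c F ⟨hF, hF'⟩
    refine ⟨hF.const_smul c, (hF'.const_mul (‖c‖ ^ 2)).congr (.of_forall fun z => ?_)⟩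
    simp only [Pi.smul_apply, norm_smul]
    ring

/-- The Fock space: a type of its own, so that it carries only the topology of the Fock norm
and not that of pointwise convergence. -/
def FockSpace : Type := ↥fockSubmodule

namespace FockSpace

noncomputable instance : AddCommGroup FockSpace := inferInstanceAs (AddCommGroup ↥fockSubmodule)

noncomputable instance : Module ℂ FockSpace := inferInstanceAs (Module ℂ ↥fockSubmodule)

instance : CoeFun FockSpace (fun _ => ℂ → ℂ) := ⟨fun F => F.1⟩

theorem ext {F G : FockSpace} (h : ∀ z, F z = G z) : F = G := Subtype.ext (funext h)

theorem differentiable (F : FockSpace) : Differentiable ℂ F := F.2.1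

theorem integrable_sq (F : FockSpace) : Integrable (fun z => ‖F z‖ ^ 2 * fockWeight z) := F.2.2

theorem add_apply (F G : FockSpace) (z : ℂ) : (F + G) z = F z + G z := rfl

theorem smul_apply (c : ℂ) (F : FockSpace) (z : ℂ) : (c • F) z = c * F z := rfl

theorem zero_apply (z : ℂ) : (0 : FockSpace) z = 0 := rfl

/-- The inner product `∫_ℂ conj(F(z)) G(z) e^{-π|z|²} dA(z)`, conjugate-linear in the first
argument as everywhere in Mathlib. -/
noncomputable def innerProd (F G : FockSpace) : ℂ :=
  ∫ z : ℂ, conj (F z) * G z * (fockWeight z : ℂ)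

theorem integrable_inner (F G : FockSpace) :
    Integrable (fun z : ℂ => conj (F z) * G z * (fockWeight z : ℂ)) := by
  refine (F.integrable_sq.add G.integrable_sq).mono' ?_ (.of_forall fun z => ?_)
  · have h1 := F.differentiable.continuous
    have h2 := G.differentiable.continuous
    have h3 := continuous_fockWeight
    exact (((Complex.continuous_conj.comp h1).mul h2).mul
      (Complex.continuous_ofReal.comp h3)).aestronglyMeasurable
  · have hw := (fockWeight_pos z).le
    simp only [norm_mul, RCLike.norm_conj, Complex.norm_real, Real.norm_of_nonneg hw,
      Pi.add_apply]
    have h1 : ‖F z‖ * ‖G z‖ ≤ ‖F z‖ ^ 2 + ‖G z‖ ^ 2 := by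
      nlinarith [sq_nonneg (‖F z‖ - ‖G z‖), sq_nonneg (‖F z‖), sq_nonneg (‖G z‖)]
    nlinarith [mul_le_mul_of_nonneg_right h1 hw]

theorem innerProd_self (F : FockSpace) :
    innerProd F F = ((∫ z : ℂ, ‖F z‖ ^ 2 * fockWeight z : ℝ) : ℂ) := by
  rw [innerProd, ← integral_complex_ofReal]
  congr 1
  funext z
  rw [Complex.conj_mul']
  push_cast
  rfl

/-- The positive definite Hermitian form of the Fock space. -/
noncomputable abbrev core : InnerProductSpace.Core ℂ FockSpace where
  inner := innerProd
  conj_inner_symm F G := by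
    simp only [innerProd]
    rw [← integral_conj]
    congr 1
    funext z
    simp only [map_mul, Complex.conj_conj, Complex.conj_ofReal]
    ring
  re_inner_nonneg F := by
    rw [innerProd_self]
    simp only [RCLike.re_to_complex, Complex.ofReal_re]
    exact integral_nonneg fun z => mul_nonneg (sq_nonneg _) (fockWeight_pos z).le
  add_left F G H := by
    simp only [innerProd]
    rw [← integral_add (integrable_inner F H) (integrable_inner G H)]
    congr 1
    funext z
    rw [add_apply, map_add]
    ring
  smul_left F G c := by
    simp only [innerProd]
    rw [← integral_const_mul]
    congr 1
    funext z
    rw [smul_apply, map_mul]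
    ring
  definite F h := by
    rw [innerProd_self, Complex.ofReal_eq_zero,
      integral_eq_zero_iff_of_nonneg
        (fun z => mul_nonneg (sq_nonneg _) (fockWeight_pos z).le) F.integrable_sq] at h
    have hc : Continuous fun z => ‖F z‖ ^ 2 * fockWeight z :=
      (F.differentiable.continuous.norm.pow 2).mul continuous_fockWeight
    have h0 := (hc.ae_eq_iff_eq volume continuous_const).1 h
    refine ext fun z => ?_
    have hz := congrFun h0 z
    rw [zero_apply, ← norm_eq_zero]
    rcases mul_eq_zero.1 hz with h1 | h1
    · exact pow_eq_zero_iff two_ne_zero |>.1 h1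
    · exact absurd h1 (fockWeight_pos z).ne'

noncomputable instance : NormedAddCommGroup FockSpace := core.toNormedAddCommGroup

noncomputable instance : InnerProductSpace ℂ FockSpace := InnerProductSpace.ofCore core.toCore

theorem inner_def (F G : FockSpace) :
    inner ℂ F G = ∫ z : ℂ, conj (F z) * G z * (fockWeight z : ℂ) := rfl

theorem norm_sq_def (F : FockSpace) : ‖F‖ ^ 2 = ∫ z : ℂ, ‖F z‖ ^ 2 * fockWeight z := by
  have h : inner ℂ F F = ((∫ z : ℂ, ‖F z‖ ^ 2 * fockWeight z : ℝ) : ℂ) := innerProd_self F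
  rw [inner_self_eq_norm_sq_to_K, ← RCLike.ofReal_pow] at h
  exact Complex.ofReal_injective h

/-- The normalized monomial `e_k(z) = π^{k/2} z^k / √(k!)`. -/
noncomputable def monomial (k : ℕ) : FockSpace :=
  ⟨fun z => ((Real.sqrt (Real.pi ^ k) : ℝ) : ℂ) * z ^ k / ((Real.sqrt (k.factorial : ℝ) : ℝ) : ℂ),
    by fun_prop, by
      have h1 : Integrable fun z : ℂ => ‖z‖ ^ ((2 * k : ℕ) : ℝ) *
          Real.exp (-Real.pi * ‖z‖ ^ (2 : ℝ)) := by
        by_contra hn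
        have h2 := integral_undef hn
        rw [Complex.integral_rpow_mul_exp_neg_mul_rpow (by norm_num)
          (by have : (0 : ℝ) ≤ ((2 * k : ℕ) : ℝ) := Nat.cast_nonneg _
              linarith) Real.pi_pos] at h2
        have h3 : 0 < Real.Gamma ((((2 * k : ℕ) : ℝ) + 2) / 2) :=
          Real.Gamma_pos_of_pos (by positivity)
        have h4 : 0 < Real.pi ^ (-(((2 * k : ℕ) : ℝ) + 2) / 2) :=
          Real.rpow_pos_of_pos Real.pi_pos _
        have h5 := Real.pi_pos
        have : 0 < (2 * Real.pi / 2) * Real.pi ^ (-(((2 * k : ℕ) : ℝ) + 2) / 2) *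
          Real.Gamma ((((2 * k : ℕ) : ℝ) + 2) / 2) := by positivity
        exact this.ne' h2
      refine (h1.const_mul ((Real.sqrt (Real.pi ^ k) / Real.sqrt (k.factorial : ℝ)) ^ 2)).congr
        (.of_forall fun z => ?_)
      simp only [Real.rpow_natCast, fockWeight, norm_mul, norm_div, norm_pow, Complex.norm_real,
        Real.norm_of_nonneg (Real.sqrt_nonneg _), Real.rpow_two, neg_mul]
      ring⟩

theorem norm_exp_sq_mul_fockWeight (w z : ℂ) :
    ‖Complex.exp (-((Real.pi * ‖w‖ ^ 2 / 2 : ℝ) : ℂ) + Real.pi * z * conj w)‖ ^ 2 * fockWeight z =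
      fockWeight (z - w) := by
  have h := Complex.sq_norm_sub_sq_re z
  rw [fockWeight, fockWeight, Complex.norm_exp, ← Real.exp_nat_mul, ← Real.exp_add]
  congr 1
  simp only [← Complex.normSq_eq_norm_sq, Complex.normSq_apply, Complex.add_re, Complex.neg_re,
    Complex.ofReal_re, Complex.mul_re, Complex.conj_re, Complex.conj_im, Complex.ofReal_im,
    Complex.sub_re, Complex.sub_im, Complex.mul_im]
  push_cast
  ring

/-- The function `𝒰_w F(z) = e^{-π|w|²/2 + π z conj(w)} F(z - w)`, an element of the Fock space. -/
noncomputable def shiftFun (w : ℂ) (F : FockSpace) : FockSpace :=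
  ⟨fun z => Complex.exp (-((Real.pi * ‖w‖ ^ 2 / 2 : ℝ) : ℂ) + Real.pi * z * conj w) * F (z - w),
    by
      have := F.differentiable
      fun_prop,
    by
      refine (F.integrable_sq.comp_sub_right w).congr (.of_forall fun z => ?_)
      simp only [norm_mul]
      rw [← norm_exp_sq_mul_fockWeight w z]
      ring⟩

theorem shiftFun_apply (w : ℂ) (F : FockSpace) (z : ℂ) : shiftFun w F z =
    Complex.exp (-((Real.pi * ‖w‖ ^ 2 / 2 : ℝ) : ℂ) + Real.pi * z * conj w) * F (z - w) := rfl

theorem shiftFun_shiftFun_neg (w : ℂ) (F : FockSpace) : shiftFun w (shiftFun (-w) F) = F := by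
  refine ext fun z => ?_
  rw [shiftFun_apply, shiftFun_apply, ← mul_assoc, ← Complex.exp_add, sub_neg_eq_add,
    sub_add_cancel]
  have h : (w * conj w : ℂ) = ((‖w‖ ^ 2 : ℝ) : ℂ) := by
    rw [Complex.mul_conj, Complex.normSq_eq_norm_sq]
  have h2 : -((Real.pi * ‖w‖ ^ 2 / 2 : ℝ) : ℂ) + Real.pi * z * conj w +
      (-((Real.pi * ‖-w‖ ^ 2 / 2 : ℝ) : ℂ) + Real.pi * (z - w) * conj (-w)) = 0 := by
    rw [norm_neg, map_neg]
    push_cast at h ⊢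
    linear_combination (Real.pi : ℂ) * h
  rw [h2, Complex.exp_zero, one_mul]

/-- The unitary operator `𝒰_w` of the Fock space,
`𝒰_w F(z) = e^{-π|w|²/2 + π z conj(w)} F(z - w)`. -/
noncomputable def shift (w : ℂ) : FockSpace ≃ₗᵢ[ℂ] FockSpace where
  toFun := shiftFun w
  invFun := shiftFun (-w)
  map_add' F G := ext fun z => by simp only [shiftFun_apply, add_apply]; ring
  map_smul' c F := ext fun z => by simp only [shiftFun_apply, smul_apply, RingHom.id_apply]; ring
  left_inv F := by simpa using shiftFun_shiftFun_neg (-w) F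
  right_inv F := shiftFun_shiftFun_neg w F
  norm_map' F := by
    have h : ‖shiftFun w F‖ ^ 2 = ‖F‖ ^ 2 := by
      rw [norm_sq_def, norm_sq_def,
        ← integral_sub_right_eq_self (fun z => ‖F z‖ ^ 2 * fockWeight z) w]
      congr 1
      funext z
      simp only [shiftFun_apply, norm_mul]
      rw [← norm_exp_sq_mul_fockWeight w z]
      ring
    exact (sq_eq_sq₀ (norm_nonneg _) (norm_nonneg _)).1 h

end FockSpace

/-- `Ω` has circular symmetry around `w`: it is the translate by `w` of a set
`{z : |z| ∈ E}` with `E ⊆ [0, ∞)` measurable. -/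
def HasCircularSymmetry (Ω : Set ℂ) (w : ℂ) : Prop :=
  ∃ E : Set ℝ, MeasurableSet E ∧ E ⊆ Set.Ici 0 ∧ Ω = {z : ℂ | ‖z - w‖ ∈ E}

/-! Since `shift w` is unitary and translates |F|² times the weight, the problem moves to w = 0.
Under t = π|z|² area becomes Lebesgue measure on (0,∞), Ω becomes a set A of length s = |Ω|, and
|e_m|² times the weight becomes the Poisson weight p_m. Averaging over rotations kills the cross
terms between monomials, so the left side is Σ q_m ∫_A p_m with q_m = Σ_k |⟨e_m, G_k⟩|²
(`occupation`). Bessel gives 0 ≤ q_m ≤ 1 and Parseval gives Σ q_m = n, so the sum is at most Σ_{m ∈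
S} ∫_A p_m for the n best indices S (`weighted_poissonMass_le`).

It remains to compare f_S = Σ_{m ∈ S} p_m on A with f_{range n} on (0,s]
(`setIntegral_poissonSum_le`). The function f_{range n} is decreasing, so with the multiplier τ =
f_{range n}(s) it suffices that ∫ (f_S - τ)_+ is largest for S = range n. Lower by one every index
beyond the first gap of S: because p_m' = p_{m-1} - p_m, this adds to f_S the derivative of the part
moved, and that derivative has nonnegative integral over {f_S > τ} (`setIntegral_deriv_nonneg`).
Finitely many moves reach the initial segment.

In the equality case A is a superlevel set of f_S and stays extremal after every move, hence is
(0,s] up to a null set. The masses of (0,s] strictly decrease in m, which forces q_m = 1 for m < n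
and q_m = 0 otherwise; this says that the coefficient matrix is unitary. -/

section HalfLine

open Set Filter Topology

/-! ### Poisson weights, their finite sums and derivatives. -/

/-- Lebesgue measure on the positive half-line. -/
noncomputable abbrev halfLine : Measure ℝ := volume.restrict (Ioi 0)

/-- The Poisson weight `t ^ m / m! * e^{-t}`. -/
noncomputable def poissonWeight (m : ℕ) (t : ℝ) : ℝ := t ^ m / (m.factorial : ℝ) * Real.exp (-t)

theorem poissonWeight_nonneg (m : ℕ) {t : ℝ} (ht : 0 ≤ t) : 0 ≤ poissonWeight m t := by
  unfold poissonWeight; positivity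

theorem poissonWeight_pos (m : ℕ) {t : ℝ} (ht : 0 < t) : 0 < poissonWeight m t := by
  unfold poissonWeight; positivity

theorem continuous_poissonWeight (m : ℕ) : Continuous (poissonWeight m) := by
  unfold poissonWeight; fun_prop

theorem poissonWeight_zero_right {m : ℕ} (hm : m ≠ 0) : poissonWeight m 0 = 0 := by
  simp [poissonWeight, hm]

/-- The derivative of the Poisson weight of index `m`. -/
noncomputable def poissonWeightDeriv (m : ℕ) (t : ℝ) : ℝ :=
  (if m = 0 then 0 else poissonWeight (m - 1) t) - poissonWeight m t

theorem continuous_poissonWeightDeriv (m : ℕ) : Continuous (poissonWeightDeriv m) := by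
  unfold poissonWeightDeriv
  have h1 := continuous_poissonWeight m
  have h2 := continuous_poissonWeight (m - 1)
  split_ifs <;> fun_prop

theorem hasDerivAt_poissonWeight (m : ℕ) (t : ℝ) :
    HasDerivAt (poissonWeight m) (poissonWeightDeriv m t) t := by
  have he : HasDerivAt (fun t : ℝ => Real.exp (-t)) (-Real.exp (-t)) t := by
    simpa using (hasDerivAt_neg t).exp
  have h := ((hasDerivAt_pow m t).div_const (m.factorial : ℝ)).mul he
  refine h.congr_deriv ?_
  unfold poissonWeightDeriv poissonWeight
  rcases m with _ | m
  · simp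
  · have : ((m + 1).factorial : ℝ) = (m + 1) * m.factorial := by
      push_cast [Nat.factorial_succ]; ring
    have h0 : (m.factorial : ℝ) ≠ 0 := by positivity
    simp only [this, Nat.add_sub_cancel, Nat.succ_ne_zero, if_false]
    push_cast
    field_simp
    ring

theorem tendsto_poissonWeight (m : ℕ) : Tendsto (poissonWeight m) atTop (𝓝 0) := by
  have h := (Real.tendsto_pow_mul_exp_neg_atTop_nhds_zero m).div_const (m.factorial : ℝ)
  rw [zero_div] at h
  refine h.congr fun t => ?_
  unfold poissonWeight; ring

theorem integrable_poissonWeight (m : ℕ) : Integrable (poissonWeight m) halfLine := by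
  have h := Real.GammaIntegral_convergent (s := (m : ℝ) + 1) (by positivity)
  refine (IntegrableOn.integrable h).div_const (m.factorial : ℝ) |>.congr (.of_forall fun t => ?_)
  simp only [add_sub_cancel_right, Real.rpow_natCast, poissonWeight]
  ring

theorem analyticOnNhd_poissonWeight (m : ℕ) : AnalyticOnNhd ℝ (poissonWeight m) univ := by
  intro t _
  unfold poissonWeight
  fun_prop

/-- The sum of the Poisson weights with index in `S`. -/
noncomputable def poissonSum (S : Finset ℕ) (t : ℝ) : ℝ := ∑ m ∈ S, poissonWeight m t

/-- The derivative of `poissonSum S`. -/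
noncomputable def poissonSumDeriv (S : Finset ℕ) (t : ℝ) : ℝ := ∑ m ∈ S, poissonWeightDeriv m t

theorem poissonSum_nonneg (S : Finset ℕ) {t : ℝ} (ht : 0 ≤ t) : 0 ≤ poissonSum S t :=
  Finset.sum_nonneg fun _ _ => poissonWeight_nonneg _ ht

theorem continuous_poissonSum (S : Finset ℕ) : Continuous (poissonSum S) :=
  continuous_finsetSum _ fun _ _ => continuous_poissonWeight _

theorem continuous_poissonSumDeriv (S : Finset ℕ) : Continuous (poissonSumDeriv S) :=
  continuous_finsetSum _ fun _ _ => continuous_poissonWeightDeriv _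

theorem hasDerivAt_poissonSum (S : Finset ℕ) (t : ℝ) :
    HasDerivAt (poissonSum S) (poissonSumDeriv S t) t :=
  HasDerivAt.fun_sum fun _ _ => hasDerivAt_poissonWeight _ _

theorem tendsto_poissonSum (S : Finset ℕ) : Tendsto (poissonSum S) atTop (𝓝 0) := by
  have h := tendsto_finsetSum S fun m _ => tendsto_poissonWeight m
  rwa [Finset.sum_const_zero] at h

theorem integrable_poissonSum (S : Finset ℕ) : Integrable (poissonSum S) halfLine :=
  integrable_finsetSum _ fun _ _ => integrable_poissonWeight _

theorem integrable_poissonSumDeriv (S : Finset ℕ) : Integrable (poissonSumDeriv S) halfLine := by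
  refine integrable_finsetSum _ fun m _ => ?_
  unfold poissonWeightDeriv
  refine Integrable.sub ?_ (integrable_poissonWeight m)
  split_ifs
  · exact integrable_zero _ _ _
  · exact integrable_poissonWeight _

/-- The sum is real-analytic and tends to 0 < τ, so it is not identically τ and its τ-points are
isolated. Level sets are therefore null and harmless exceptional sets for the fundamental theorem of
calculus. -/
theorem countable_poissonSum_eq (S : Finset ℕ) {τ : ℝ} (hτ : 0 < τ) :
    {t | poissonSum S t = τ}.Countable := by
  have ha : AnalyticOnNhd ℝ (fun t => poissonSum S t - τ) univ := by
    refine AnalyticOnNhd.sub ?_ analyticOnNhd_const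
    exact Finset.analyticOnNhd_fun_sum S fun m _ => analyticOnNhd_poissonWeight m
  obtain ⟨x, hx⟩ := ((tendsto_poissonSum S).eventually (gt_mem_nhds hτ)).exists
  have h := ha.preimage_zero_mem_codiscrete (x := x) (sub_ne_zero.2 hx.ne)
  have h2 := (mem_codiscrete'.1 h).2
  have h3 : ((fun t => poissonSum S t - τ) ⁻¹' {0}ᶜ)ᶜ = {t | poissonSum S t = τ} := by
    ext t; simp [sub_eq_zero]
  rw [h3] at h2
  exact IsLindelof.countable_of_isDiscrete (HereditarilyLindelofSpace.isLindelof _) h2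

/-! ### Integrals of derivatives over superlevel sets. -/

/-- The fundamental theorem of calculus for the positive part of `f - τ`. -/
theorem integral_indicator_deriv {f f' : ℝ → ℝ} {τ R : ℝ}
    (hf : ∀ x, HasDerivAt f (f' x) x) (hf' : Continuous f') (hc : {t | f t = τ}.Countable)
    (hfR : f R ≤ τ) :
    ∫ t in 0..R, {t | τ < f t}.indicator f' t = -max (f 0 - τ) 0 := by
  have hfc : Continuous f := continuous_iff_continuousAt.2 fun x => (hf x).continuousAt
  have ho : IsOpen {t | τ < f t} := isOpen_lt continuous_const hfc
  -- The positive part is differentiable wherever f ≠ τ, with derivative f' or 0.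
  rw [MeasureTheory.integral_eq_of_hasDerivAt_off_countable (fun t => max (f t - τ) 0) _ hc
    (by fun_prop)]
  · simp [max_eq_right (sub_nonpos.2 hfR)]
  · rintro x ⟨-, hx⟩
    rcases lt_or_gt_of_ne (show f x ≠ τ from hx) with h | h
    · have : x ∉ {t | τ < f t} := not_lt.2 h.le
      rw [indicator_of_notMem this]
      refine (hasDerivAt_const x (0 : ℝ)).congr_of_eventuallyEq ?_
      filter_upwards [(isOpen_lt hfc continuous_const).mem_nhds h] with y hy
      exact max_eq_right (sub_nonpos.2 (le_of_lt hy))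
    · have hm : x ∈ {t | τ < f t} := h
      rw [indicator_of_mem hm]
      refine ((hf x).sub_const τ).congr_of_eventuallyEq ?_
      filter_upwards [ho.mem_nhds h] with y hy
      exact max_eq_left (sub_nonneg.2 (le_of_lt hy))
  · have := hf'.intervalIntegrable (μ := volume) 0 R
    rw [intervalIntegrable_iff] at this ⊢
    exact this.indicator ho.measurableSet

/-- As ψ(0) = 0, the integrals of γ' + ψ' over {γ + ψ > τ} and of γ' over {γ > τ} both equal -(γ(0)
- τ)_+. Since ψ ≥ 0 the first set contains the second, and γ' ≤ 0 on the difference, so the ψ' part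
must be nonnegative. -/
theorem setIntegral_deriv_nonneg {γ ψ γ' ψ' : ℝ → ℝ} {τ : ℝ}
    (hγ : ∀ x, HasDerivAt γ (γ' x) x) (hψ : ∀ x, HasDerivAt ψ (ψ' x) x)
    (hγ' : Continuous γ') (hψ' : Continuous ψ')
    (hcγ : {t | γ t = τ}.Countable) (hc : {t | γ t + ψ t = τ}.Countable)
    (hγ'_nonpos : ∀ t, 0 ≤ t → γ' t ≤ 0) (hψ_nonneg : ∀ t, 0 ≤ t → 0 ≤ ψ t) (hψ0 : ψ 0 = 0)
    (hlim : ∀ᶠ t in atTop, γ t + ψ t < τ) :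
    0 ≤ ∫ t in {t | τ < γ t + ψ t}, ψ' t ∂halfLine := by
  obtain ⟨R₀, hR₀⟩ := eventually_atTop.1 hlim
  -- Beyond R the superlevel set is empty, so the half-line may be cut to [0, R].
  set R := max R₀ 0
  have hR : 0 ≤ R := le_max_right _ _
  have hlt : ∀ t, R ≤ t → γ t + ψ t < τ := fun t ht => hR₀ t ((le_max_left _ _).trans ht)
  have hγc : Continuous γ := continuous_iff_continuousAt.2 fun x => (hγ x).continuousAt
  have hψc : Continuous ψ := continuous_iff_continuousAt.2 fun x => (hψ x).continuousAt
  have hB : MeasurableSet {t | τ < γ t + ψ t} :=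
    (isOpen_lt continuous_const (hγc.add hψc)).measurableSet
  have hC : MeasurableSet {t | τ < γ t} := (isOpen_lt continuous_const hγc).measurableSet
  have h1 : ∫ t in {t | τ < γ t + ψ t}, ψ' t ∂halfLine
      = ∫ t in 0..R, {t | τ < γ t + ψ t}.indicator ψ' t := by
    rw [intervalIntegral.integral_of_le hR, setIntegral_indicator hB, Measure.restrict_restrict hB]
    congr 2
    ext t
    simp only [mem_inter_iff, mem_ofPred_eq, mem_Ioi, mem_Ioc]
    constructor
    · rintro ⟨h, h0⟩
      exact ⟨⟨h0, le_of_not_gt fun hgt => absurd (hlt t hgt.le) (not_lt.2 h.le)⟩, h⟩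
    · rintro ⟨⟨h0, -⟩, h⟩
      exact ⟨h, h0⟩
  have hγψ' : Continuous fun t => γ' t + ψ' t := hγ'.add hψ'
  have hi : ∀ {g : ℝ → ℝ} {s : Set ℝ}, Continuous g → MeasurableSet s →
      IntervalIntegrable (s.indicator g) volume 0 R := by
    intro g s hg hs
    have := hg.intervalIntegrable (μ := volume) 0 R
    rw [intervalIntegrable_iff] at this ⊢
    exact this.indicator hs
  have h2 := integral_indicator_deriv (fun x => (hγ x).add (hψ x)) (hγ'.add hψ') hc
    (hlt R le_rfl).le
  have h3 := integral_indicator_deriv hγ hγ' hcγ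
    (by linarith [hlt R le_rfl, hψ_nonneg R hR])
  have h4 : ∫ t in 0..R, ({t | τ < γ t + ψ t}.indicator (fun t => γ' t + ψ' t) t
      - {t | τ < γ t}.indicator γ' t) ≤ ∫ t in 0..R, {t | τ < γ t + ψ t}.indicator ψ' t := by
    refine intervalIntegral.integral_mono_on hR ((hi hγψ' hB).sub (hi hγ' hC))
      (hi hψ' hB) fun t ht => ?_
    have e1 := hγ'_nonpos t ht.1
    have e2 := hψ_nonneg t ht.1
    simp only [indicator, mem_ofPred_eq]
    split_ifs <;> linarith
  rw [intervalIntegral.integral_sub (hi hγψ' hB) (hi hγ' hC)] at h4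
  simp only [Pi.add_apply, hψ0, add_zero] at h2
  rw [h1]
  have h2' : ∫ t in 0..R, {t | τ < γ t + ψ t}.indicator (fun t => γ' t + ψ' t) t
    = -max (γ 0 - τ) 0 := h2
  linarith

/-- The derivatives p_{m-1} - p_m telescope. Hence sums over initial segments decrease. -/
theorem poissonSumDeriv_range (n : ℕ) (t : ℝ) :
    poissonSumDeriv (Finset.range (n + 1)) t = -poissonWeight n t := by
  induction n with
  | zero => simp [poissonSumDeriv, poissonWeightDeriv]
  | succ n ih =>
    have : poissonSumDeriv (Finset.range (n + 1 + 1)) t =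
        poissonSumDeriv (Finset.range (n + 1)) t + poissonWeightDeriv (n + 1) t :=
      Finset.sum_range_succ _ _
    rw [this, ih]
    simp only [poissonWeightDeriv, Nat.succ_ne_zero, if_false, Nat.add_sub_cancel]
    ring

theorem poissonSumDeriv_range_nonpos (n : ℕ) {t : ℝ} (ht : 0 ≤ t) :
    poissonSumDeriv (Finset.range n) t ≤ 0 := by
  rcases n with _ | n
  · simp [poissonSumDeriv]
  · rw [poissonSumDeriv_range]
    exact neg_nonpos.2 (poissonWeight_nonneg _ ht)

theorem strictAntiOn_poissonSum_range {n : ℕ} (hn : 1 ≤ n) :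
    StrictAntiOn (poissonSum (Finset.range n)) (Ici 0) := by
  obtain ⟨n, rfl⟩ := Nat.exists_eq_add_of_le' hn
  refine strictAntiOn_of_deriv_neg (convex_Ici 0) (continuous_poissonSum _).continuousOn ?_
  intro t ht
  rw [interior_Ici] at ht
  rw [(hasDerivAt_poissonSum _ t).deriv, poissonSumDeriv_range]
  exact neg_neg_of_pos (poissonWeight_pos _ ht)

/-! ### Shifting index sets towards an initial segment. -/

/-- A finite set of naturals which is not an initial segment can be shifted down beyond its first
gap, and the sum of Poisson weights then changes by the derivative of the part shifted. -/
theorem exists_shift {S : Finset ℕ} (hS : S ≠ Finset.range S.card) :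
    ∃ (T : Finset ℕ) (j : ℕ) (S' : Finset ℕ), T.card = S.card ∧ ∑ m ∈ T, m < ∑ m ∈ S, m ∧
      (∀ m ∈ S', m ≠ 0) ∧ (∀ t, poissonSum S t = poissonSum (Finset.range j) t + poissonSum S' t) ∧
      ∀ t, poissonSum T t = poissonSum S t + poissonSumDeriv S' t := by
  classical
  have hex : ∃ j, j ∉ S := Infinite.exists_notMem_finset S
  set j := Nat.find hex with hj
  have hjS : j ∉ S := Nat.find_spec hex
  have hlt : ∀ m < j, m ∈ S := fun m hm => not_not.1 (Nat.find_min hex hm)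
  set S' := S.filter (j < ·) with hS'
  have hdecomp : S = Finset.range j ∪ S' := by
    ext m
    simp only [hS', Finset.mem_union, Finset.mem_range, Finset.mem_filter]
    constructor
    · intro hm
      rcases lt_trichotomy m j with h | h | h
      · exact .inl h
      · exact absurd (h ▸ hm) hjS
      · exact .inr ⟨hm, h⟩
    · rintro (h | h)
      exacts [hlt m h, h.1]
  have hS'j : ∀ m ∈ S', j < m := fun m hm => (Finset.mem_filter.1 hm).2
  have hdisj : Disjoint (Finset.range j) S' := by
    rw [Finset.disjoint_left]
    intro m hm hm'
    have := hS'j m hm'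
    rw [Finset.mem_range] at hm
    omega
  have hne : S'.Nonempty := by
    rw [Finset.nonempty_iff_ne_empty]
    intro he
    rw [he, Finset.union_empty] at hdecomp
    apply hS
    conv_lhs => rw [hdecomp]
    rw [hdecomp, Finset.card_range]
  -- Every index in S' exceeds j, so the truncated subtraction is a true predecessor and its value
  -- is still at least j.
  have hinj : Set.InjOn (fun m : ℕ => m - 1) S' := by
    intro a ha b hb hab
    have h1 := hS'j a ha
    have h2 := hS'j b hb
    simp only at hab
    omega
  have hdisj' : Disjoint (Finset.range j) (S'.image (fun m => m - 1)) := by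
    rw [Finset.disjoint_left]
    intro m hm hm'
    obtain ⟨a, ha, rfl⟩ := Finset.mem_image.1 hm'
    have := hS'j a ha
    rw [Finset.mem_range] at hm
    omega
  refine ⟨Finset.range j ∪ S'.image (fun m => m - 1), j, S', ?_, ?_, ?_, ?_, ?_⟩
  · rw [Finset.card_union_of_disjoint hdisj', Finset.card_image_of_injOn hinj]
    conv_rhs => rw [hdecomp, Finset.card_union_of_disjoint hdisj]
  · conv_rhs => rw [hdecomp, Finset.sum_union hdisj]
    rw [Finset.sum_union hdisj', Finset.sum_image hinj]
    refine Nat.add_lt_add_left (Finset.sum_lt_sum_of_nonempty hne fun m hm => ?_) _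
    have := hS'j m hm
    omega
  · intro m hm
    have := hS'j m hm
    omega
  · intro t
    conv_lhs => rw [hdecomp, poissonSum, Finset.sum_union hdisj]
    rfl
  · intro t
    conv_rhs => rw [hdecomp, poissonSum, Finset.sum_union hdisj]
    rw [poissonSum, Finset.sum_union hdisj', Finset.sum_image hinj, poissonSumDeriv, add_assoc,
      ← Finset.sum_add_distrib]
    congr 1
    refine Finset.sum_congr rfl fun m hm => ?_
    have : m ≠ 0 := by have := hS'j m hm; omega
    simp [poissonWeightDeriv, this]

/-- The set T does not depend on τ, and the drop in the sum of indices makes the move usable in a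
strong induction. The domain of integration is the superlevel set of the old sum on both sides. -/
theorem exists_shift_setIntegral {S : Finset ℕ} (hS : S ≠ Finset.range S.card) :
    ∃ T : Finset ℕ, T.card = S.card ∧ ∑ m ∈ T, m < ∑ m ∈ S, m ∧ ∀ τ : ℝ, 0 < τ →
      ∫ t in {t | τ < poissonSum S t}, poissonSum S t ∂halfLine ≤
        ∫ t in {t | τ < poissonSum S t}, poissonSum T t ∂halfLine := by
  obtain ⟨T, j, S', h1, h2, h3, h4, h5⟩ := exists_shift hS
  refine ⟨T, h1, h2, fun τ hτ => ?_⟩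
  have h := setIntegral_deriv_nonneg (τ := τ) (hasDerivAt_poissonSum (Finset.range j))
    (hasDerivAt_poissonSum S') (continuous_poissonSumDeriv _) (continuous_poissonSumDeriv _)
    (countable_poissonSum_eq _ hτ) (by simpa only [h4] using countable_poissonSum_eq S hτ)
    (fun t ht => poissonSumDeriv_range_nonpos j ht) (fun t ht => poissonSum_nonneg S' ht)
    (Finset.sum_eq_zero fun m hm => poissonWeight_zero_right (h3 m hm))
    (by simpa only [h4] using (tendsto_poissonSum S).eventually (gt_mem_nhds hτ))
  simp only [← h4] at h
  simp only [h5]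
  rw [integral_add (integrable_poissonSum S).integrableOn
    (integrable_poissonSumDeriv S').integrableOn]
  linarith

end HalfLine

/-! ### Optimal sets and index sets through the positive part. -/

section Excess

open Set Filter Topology

/-- The integral over the half-line of the positive part of `poissonSum S - τ`. -/
noncomputable def poissonExcess (S : Finset ℕ) (τ : ℝ) : ℝ :=
  ∫ t, max (poissonSum S t - τ) 0 ∂halfLine

theorem integrable_poissonSum_posPart (S : Finset ℕ) {τ : ℝ} (hτ : 0 < τ) :
    Integrable (fun t => max (poissonSum S t - τ) 0) halfLine := by
  have hc := continuous_poissonSum S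
  refine (integrable_poissonSum S).mono' (by fun_prop) ?_
  refine (ae_restrict_iff' measurableSet_Ioi).2 (.of_forall fun t ht => ?_)
  have h0 := poissonSum_nonneg S (le_of_lt ht)
  rw [Real.norm_of_nonneg (le_max_right _ _)]
  exact max_le (by linarith) h0

theorem integrableOn_poissonSum_sub (S : Finset ℕ) (τ : ℝ) {A : Set ℝ} (hA : halfLine A < ⊤) :
    IntegrableOn (fun t => poissonSum S t - τ) A halfLine :=
  (integrable_poissonSum S).integrableOn.sub (integrableOn_const hA.ne)

theorem setIntegral_poissonSum_sub (S : Finset ℕ) (τ : ℝ) {A : Set ℝ} (hA : halfLine A < ⊤) :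
    ∫ t in A, (poissonSum S t - τ) ∂halfLine =
      ∫ t in A, poissonSum S t ∂halfLine - τ * (halfLine A).toReal := by
  rw [integral_sub (integrable_poissonSum S).integrableOn (integrableOn_const hA.ne),
    setIntegral_const, smul_eq_mul, mul_comm τ]
  rfl

theorem measurableSet_poissonSum_gt (S : Finset ℕ) (τ : ℝ) : MeasurableSet {t | τ < poissonSum S t} :=
  (isOpen_lt continuous_const (continuous_poissonSum S)).measurableSet

theorem measure_poissonSum_gt_lt_top (S : Finset ℕ) {τ : ℝ} (hτ : 0 < τ) :
    halfLine {t | τ < poissonSum S t} < ⊤ :=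
  (integrable_poissonSum S).measure_gt_lt_top hτ

theorem poissonExcess_eq_setIntegral (S : Finset ℕ) (τ : ℝ) :
    poissonExcess S τ = ∫ t in {t | τ < poissonSum S t}, (poissonSum S t - τ) ∂halfLine := by
  rw [poissonExcess, ← integral_indicator (measurableSet_poissonSum_gt S τ)]
  congr 1
  funext t
  simp only [indicator, mem_ofPred_eq]
  split_ifs with h
  · exact max_eq_left (by linarith)
  · exact max_eq_right (by linarith)

theorem setIntegral_sub_le_poissonExcess (S : Finset ℕ) {τ : ℝ} (hτ : 0 < τ) {A : Set ℝ}
    (hA : halfLine A < ⊤) :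
    ∫ t in A, (poissonSum S t - τ) ∂halfLine ≤ poissonExcess S τ := by
  refine (setIntegral_mono (integrableOn_poissonSum_sub S τ hA)
    (integrable_poissonSum_posPart S hτ).integrableOn fun t => le_max_left _ 0).trans ?_
  exact setIntegral_le_integral (integrable_poissonSum_posPart S hτ)
    (.of_forall fun t => le_max_right _ _)

/-- On {f_S > τ} a downward shift does not lower the integral, and the excess of T dominates the
integral of f_T - τ over any set of finite measure. Induction on the sum of the indices concludes.
-/
theorem poissonExcess_le_range (S : Finset ℕ) {τ : ℝ} (hτ : 0 < τ) :
    poissonExcess S τ ≤ poissonExcess (Finset.range S.card) τ := by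
  induction hN : ∑ m ∈ S, m using Nat.strong_induction_on generalizing S with
  | _ N ih =>
    by_cases hS : S = Finset.range S.card
    · exact le_of_eq (congrArg (poissonExcess · τ) hS)
    · obtain ⟨T, h1, h2, h3⟩ := exists_shift_setIntegral hS
      have h4 := ih _ (hN ▸ h2) T rfl
      rw [h1] at h4
      refine le_trans ?_ h4
      have hB := measure_poissonSum_gt_lt_top S hτ
      refine le_trans ?_ (setIntegral_sub_le_poissonExcess T hτ hB)
      rw [poissonExcess_eq_setIntegral, setIntegral_poissonSum_sub _ _ hB,
        setIntegral_poissonSum_sub _ _ hB]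
      linarith [h3 τ hτ]

theorem halfLine_Iic {s : ℝ} : halfLine (Iic s) = ENNReal.ofReal s := by
  rw [Measure.restrict_apply measurableSet_Iic, inter_comm, Ioi_inter_Iic, Real.volume_Ioc,
    sub_zero]

theorem ae_halfLine_pos : ∀ᵐ t ∂halfLine, 0 < t :=
  (ae_restrict_iff' measurableSet_Ioi).2 (.of_forall fun _ ht => ht)

theorem poissonSum_gt_ae_eq_Iic {n : ℕ} (hn : 1 ≤ n) {s : ℝ} (hs : 0 < s) :
    ({t | poissonSum (Finset.range n) s < poissonSum (Finset.range n) t} : Set ℝ)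
      =ᵐ[halfLine] Iic s := by
  have h1 : (Iio s : Set ℝ) =ᵐ[halfLine] Iic s := ae_restrict_of_ae Iio_ae_eq_Iic
  refine EventuallyEq.trans ?_ h1
  filter_upwards [ae_halfLine_pos] with t ht
  exact propext ((strictAntiOn_poissonSum_range hn).lt_iff_gt (mem_Ici.2 hs.le)
    (mem_Ici.2 ht.le))

theorem poissonExcess_range {n : ℕ} (hn : 1 ≤ n) {s : ℝ} (hs : 0 < s) :
    poissonExcess (Finset.range n) (poissonSum (Finset.range n) s) =
      ∫ t in Iic s, poissonSum (Finset.range n) t ∂halfLine -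
        poissonSum (Finset.range n) s * s := by
  rw [poissonExcess_eq_setIntegral, setIntegral_congr_set (poissonSum_gt_ae_eq_Iic hn hs),
    setIntegral_poissonSum_sub _ _ (by rw [halfLine_Iic]; exact ENNReal.ofReal_lt_top),
    halfLine_Iic, ENNReal.toReal_ofReal hs.le]

theorem poissonSum_range_pos {n : ℕ} (hn : 1 ≤ n) {s : ℝ} (hs : 0 < s) :
    0 < poissonSum (Finset.range n) s :=
  Finset.sum_pos (fun _ _ => poissonWeight_pos _ hs) (Finset.nonempty_range_iff.2 (by omega))

/-- Lagrange multiplier argument: at τ = f_{range}(s) the excess of the initial segment is attained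
on (0,s], and the terms τ·s on the two sides cancel because A has length s. -/
theorem setIntegral_poissonSum_le {S : Finset ℕ} (hS : 1 ≤ S.card) {s : ℝ} (hs : 0 < s)
    {A : Set ℝ} (hA : halfLine A = ENNReal.ofReal s) :
    ∫ t in A, poissonSum S t ∂halfLine ≤
      ∫ t in Iic s, poissonSum (Finset.range S.card) t ∂halfLine := by
  have hτ := poissonSum_range_pos hS hs
  have hA' : halfLine A < ⊤ := by rw [hA]; exact ENNReal.ofReal_lt_top
  have h1 := setIntegral_sub_le_poissonExcess S hτ hA'
  have h2 := poissonExcess_le_range S hτ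
  rw [poissonExcess_range hS hs] at h2
  rw [setIntegral_poissonSum_sub _ _ hA', hA, ENNReal.toReal_ofReal hs.le] at h1
  linarith

/-- A set attaining the maximum of `∫_A poissonSum S` is a superlevel set. -/
theorem ae_eq_superlevel_of_le {S : Finset ℕ} (hS : 1 ≤ S.card) {s : ℝ} (hs : 0 < s)
    {A : Set ℝ} (hAm : MeasurableSet A) (hA : halfLine A = ENNReal.ofReal s)
    (h : ∫ t in Iic s, poissonSum (Finset.range S.card) t ∂halfLine ≤
      ∫ t in A, poissonSum S t ∂halfLine) :
    A =ᵐ[halfLine] {t | poissonSum (Finset.range S.card) s < poissonSum S t} := by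
  set τ := poissonSum (Finset.range S.card) s
  have hτ : 0 < τ := poissonSum_range_pos hS hs
  have hA' : halfLine A < ⊤ := by rw [hA]; exact ENNReal.ofReal_lt_top
  have h2 := poissonExcess_le_range S hτ
  rw [poissonExcess_range hS hs] at h2
  have h1 := setIntegral_poissonSum_sub S τ hA'
  rw [hA, ENNReal.toReal_ofReal hs.le, ← integral_indicator hAm] at h1
  have hint1 := integrable_poissonSum_posPart S hτ
  have hint2 := (integrableOn_poissonSum_sub S τ hA').integrable_indicator hAm
  have hnn : 0 ≤ fun t => max (poissonSum S t - τ) 0 -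
      A.indicator (fun t => poissonSum S t - τ) t := by
    intro t
    simp only [indicator, Pi.zero_apply]
    split_ifs
    · exact sub_nonneg.2 (le_max_left _ _)
    · exact sub_nonneg.2 (le_max_right _ _)
  -- Extremality makes the integral of this nonnegative function vanish, so the function is zero
  -- almost everywhere.
  have h3 : ∫ t, (max (poissonSum S t - τ) 0 -
      A.indicator (fun t => poissonSum S t - τ) t) ∂halfLine = 0 := by
    refine le_antisymm ?_ (integral_nonneg hnn)
    rw [integral_sub hint1 hint2, h1]
    have : poissonExcess S τ = ∫ t, max (poissonSum S t - τ) 0 ∂halfLine := rfl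
    linarith
  rw [integral_eq_zero_iff_of_nonneg hnn (hint1.sub hint2)] at h3
  have hlevel : ∀ᵐ t ∂halfLine, poissonSum S t ≠ τ := by
    refine ae_restrict_of_ae ?_
    exact compl_mem_ae_iff.2 ((countable_poissonSum_eq S hτ).measure_zero volume)
  filter_upwards [h3, hlevel] with t ht hne
  simp only [indicator, Pi.zero_apply] at ht
  refine propext (show t ∈ A ↔ τ < poissonSum S t from ?_)
  split_ifs at ht with htA
  · refine iff_of_true htA (lt_of_le_of_ne ?_ hne.symm)
    have := le_max_right (poissonSum S t - τ) 0
    linarith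
  · refine iff_of_false htA (not_lt.2 ?_)
    have := le_max_left (poissonSum S t - τ) 0
    linarith

/-- An extremal A is a superlevel set of f_S, exactly where the shift inequality applies, so the
same A is extremal for T. The descent ends at an initial segment, whose superlevel sets are
intervals by monotonicity. -/
theorem ae_eq_Iic_of_le {S : Finset ℕ} (hS : 1 ≤ S.card) {s : ℝ} (hs : 0 < s)
    {A : Set ℝ} (hAm : MeasurableSet A) (hA : halfLine A = ENNReal.ofReal s)
    (h : ∫ t in Iic s, poissonSum (Finset.range S.card) t ∂halfLine ≤
      ∫ t in A, poissonSum S t ∂halfLine) :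
    A =ᵐ[halfLine] Iic s := by
  induction hN : ∑ m ∈ S, m using Nat.strong_induction_on generalizing S with
  | _ N ih =>
    have hB := ae_eq_superlevel_of_le hS hs hAm hA h
    by_cases hSr : S = Finset.range S.card
    · refine hB.trans ?_
      have := poissonSum_gt_ae_eq_Iic hS hs
      rwa [← hSr] at this ⊢
    · obtain ⟨T, h1, h2, h3⟩ := exists_shift_setIntegral hSr
      refine ih _ (hN ▸ h2) (S := T) (h1 ▸ hS) ?_ rfl
      rw [h1]
      refine h.trans ?_
      rw [setIntegral_congr_set hB, setIntegral_congr_set hB]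
      exact h3 _ (poissonSum_range_pos hS hs)

end Excess

/-! ### Masses of the Poisson weights and their values on an interval. -/

section Eigenvalue

open Set Filter Topology

/-- The integral of the Poisson weight of index `m` over `A`. -/
noncomputable def poissonMass (A : Set ℝ) (m : ℕ) : ℝ := ∫ t in A, poissonWeight m t ∂halfLine

theorem sum_poissonMass (A : Set ℝ) (S : Finset ℕ) :
    ∑ m ∈ S, poissonMass A m = ∫ t in A, poissonSum S t ∂halfLine :=
  (integral_finsetSum S fun m _ => (integrable_poissonWeight m).integrableOn).symm

theorem poissonMass_nonneg (A : Set ℝ) (m : ℕ) : 0 ≤ poissonMass A m := by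
  refine integral_nonneg_of_ae (ae_restrict_of_ae ?_)
  filter_upwards [ae_halfLine_pos] with t ht
  exact poissonWeight_nonneg m ht.le

theorem poissonMass_pos {A : Set ℝ} (hA : 0 < halfLine A) (m : ℕ) : 0 < poissonMass A m := by
  have hpos : ∀ᵐ t ∂(halfLine.restrict A), 0 < poissonWeight m t := by
    refine ae_restrict_of_ae ?_
    filter_upwards [ae_halfLine_pos] with t ht
    exact poissonWeight_pos m ht
  rw [poissonMass, integral_pos_iff_support_of_nonneg_ae (hpos.mono fun _ h => h.le)
    (integrable_poissonWeight m).integrableOn]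
  have : (Function.support fun t => poissonWeight m t) =ᵐ[halfLine.restrict A] univ := by
    filter_upwards [hpos] with t ht
    exact propext (iff_of_true ht.ne' trivial)
  rwa [measure_congr this, Measure.restrict_apply_univ]

/-- The weights sum to at most 1 at each point, so the masses are summable with total at most the
length of A. -/
theorem tendsto_poissonMass {A : Set ℝ} (hA : halfLine A < ⊤) :
    Tendsto (poissonMass A) atTop (𝓝 0) := by
  refine (summable_of_sum_range_le (c := (halfLine A).toReal) (poissonMass_nonneg A)
    fun n => ?_).tendsto_atTop_zero
  rw [sum_poissonMass]
  have h : ∫ t in A, poissonSum (Finset.range n) t ∂halfLine ≤ ∫ t in A, (1 : ℝ) ∂halfLine := by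
    refine integral_mono_ae (integrable_poissonSum _).integrableOn (integrableOn_const hA.ne)
      (ae_restrict_of_ae ?_)
    filter_upwards [ae_halfLine_pos] with t ht
    have h1 := Real.sum_le_exp_of_nonneg ht.le n
    simp only [poissonSum, poissonWeight, ← Finset.sum_mul]
    calc _ ≤ Real.exp t * Real.exp (-t) := by gcongr
      _ = 1 := by rw [← Real.exp_add]; simp
  refine h.trans (le_of_eq ?_)
  rw [setIntegral_const, smul_eq_mul, mul_one]
  rfl

theorem poissonMass_congr {A B : Set ℝ} (h : A =ᵐ[halfLine] B) : poissonMass A = poissonMass B :=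
  funext fun _ => setIntegral_congr_set h

theorem poissonMass_Iic_eq_intervalIntegral {s : ℝ} (hs : 0 ≤ s) (m : ℕ) :
    poissonMass (Iic s) m = ∫ t in 0..s, poissonWeight m t := by
  rw [poissonMass, Measure.restrict_restrict measurableSet_Iic, inter_comm, Ioi_inter_Iic,
    intervalIntegral.integral_of_le hs]

theorem poissonMass_Iic_eq_one_sub {s : ℝ} (hs : 0 ≤ s) (m : ℕ) :
    poissonMass (Iic s) m = 1 - poissonSum (Finset.range (m + 1)) s := by
  have h := intervalIntegral.integral_eq_sub_of_hasDerivAt (a := 0) (b := s)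
    (fun t _ => hasDerivAt_poissonSum (Finset.range (m + 1)) t)
    ((continuous_poissonSumDeriv _).intervalIntegrable _ _)
  simp only [poissonSumDeriv_range, intervalIntegral.integral_neg] at h
  rw [← poissonMass_Iic_eq_intervalIntegral hs] at h
  have h0 : poissonSum (Finset.range (m + 1)) 0 = 1 := by
    rw [poissonSum, Finset.sum_range_succ',
      Finset.sum_eq_zero fun k _ => poissonWeight_zero_right k.succ_ne_zero]
    simp [poissonWeight]
  linarith

theorem strictAnti_poissonMass_Iic {s : ℝ} (hs : 0 < s) : StrictAnti (poissonMass (Iic s)) := by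
  refine strictAnti_nat_of_succ_lt fun m => ?_
  rw [poissonMass_Iic_eq_one_sub hs.le, poissonMass_Iic_eq_one_sub hs.le]
  have : poissonSum (Finset.range (m + 1 + 1)) s =
    poissonSum (Finset.range (m + 1)) s + poissonWeight (m + 1) s := Finset.sum_range_succ _ _
  have := poissonWeight_pos (m + 1) hs
  linarith

theorem sum_poissonMass_Iic {s : ℝ} (hs : 0 ≤ s) (n : ℕ) :
    ∑ m ∈ Finset.range n, poissonMass (Iic s) m = (n : ℝ) - ∑ k ∈ Finset.range n,
      ((n : ℝ) - (k : ℝ)) * (s ^ k / (k.factorial : ℝ)) * Real.exp (-s) := by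
  induction n with
  | zero => simp
  | succ n ih =>
    rw [Finset.sum_range_succ, ih, poissonMass_Iic_eq_one_sub hs, Finset.sum_range_succ,
      poissonSum, Finset.sum_range_succ]
    have : ∑ k ∈ Finset.range n, (((n + 1 : ℕ) : ℝ) - (k : ℝ)) * (s ^ k / (k.factorial : ℝ)) *
        Real.exp (-s) = ∑ k ∈ Finset.range n, ((n : ℝ) - (k : ℝ)) * (s ^ k / (k.factorial : ℝ)) *
        Real.exp (-s) + ∑ k ∈ Finset.range n, poissonWeight k s := by
      rw [← Finset.sum_add_distrib]
      refine Finset.sum_congr rfl fun k _ => ?_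
      unfold poissonWeight
      push_cast
      ring
    rw [this]
    unfold poissonWeight
    push_cast
    ring

end Eigenvalue

/-! ### The bathtub principle for weights in [0, 1]. -/

section Bathtub

open Set Filter Topology

theorem exists_finset_top {l : ℕ → ℝ} (hpos : ∀ m, 0 < l m) (hl : Tendsto l atTop (𝓝 0)) (n : ℕ) :
    ∃ S : Finset ℕ, S.card = n ∧ ∀ i ∈ S, ∀ j ∉ S, l j ≤ l i := by
  classical
  induction n with
  | zero => exact ⟨∅, by simp⟩
  | succ n ih =>
    obtain ⟨S, hS, h⟩ := ih
    obtain ⟨j₀, hj₀⟩ := Infinite.exists_notMem_finset S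
    -- Convergence to 0 leaves finitely many competitors of j₀, so a largest remaining value exists.
    have hfin : {j | j ∉ S ∧ l j₀ ≤ l j}.Finite := by
      obtain ⟨N, hN⟩ := eventually_atTop.1 (hl.eventually (gt_mem_nhds (hpos j₀)))
      refine (finite_lt_nat N).subset fun j hj => ?_
      exact lt_of_not_ge fun hge => absurd (hN j hge) (not_lt.2 hj.2)
    obtain ⟨a, ha, hmax⟩ := exists_max_image _ l hfin ⟨j₀, hj₀, le_rfl⟩
    have hmax' : ∀ j ∉ S, l j ≤ l a := fun j hj => by
      by_cases hc : l j₀ ≤ l j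
      · exact hmax j ⟨hj, hc⟩
      · exact (le_of_not_ge hc).trans ha.2
    refine ⟨insert a S, by rw [Finset.card_insert_of_notMem ha.1, hS], ?_⟩
    intro i hi j hj
    rw [Finset.mem_insert, not_or] at hj
    rcases Finset.mem_insert.1 hi with rfl | hi
    · exact hmax' j hj.2
    · exact h i hi j hj.2

/-- The constant c drops out because p and the indicator of S have the same total. When c separates
the values of l on S from the others, every term is nonpositive. -/
theorem hasSum_bathtub {l p : ℕ → ℝ} {S : Finset ℕ} {L : ℝ} (c : ℝ)
    (hp : HasSum p S.card) (hL : HasSum (fun m => p m * l m) L) :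
    HasSum (fun m => (p m - if m ∈ S then 1 else 0) * (l m - c)) (L - ∑ m ∈ S, l m) := by
  have h (f : ℕ → ℝ) : HasSum (fun m => if m ∈ S then f m else 0) (∑ m ∈ S, f m) := by
    have := hasSum_sum_of_ne_finset_zero (L := .unconditional ℕ) (s := S)
      (f := fun m => if m ∈ S then f m else 0) fun m hm => if_neg hm
    rwa [Finset.sum_congr rfl fun m hm => if_pos hm] at this
  have h1 := (hL.sub (h l)).sub ((hp.sub (h fun _ => 1)).mul_right c)
  simp only [Finset.sum_const, nsmul_eq_mul, mul_one, sub_self, zero_mul, sub_zero] at h1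
  refine h1.congr_fun fun m => ?_
  split_ifs <;> ring

theorem bathtub_le {l p : ℕ → ℝ} {S : Finset ℕ} {L c : ℝ} (hp0 : ∀ m, 0 ≤ p m)
    (hp1 : ∀ m, p m ≤ 1) (hp : HasSum p S.card) (hL : HasSum (fun m => p m * l m) L)
    (hS : ∀ m ∈ S, c ≤ l m) (hS' : ∀ m ∉ S, l m ≤ c) : L ≤ ∑ m ∈ S, l m := by
  refine sub_nonpos.1 (hasSum_le (fun m => ?_) (hasSum_bathtub c hp hL) hasSum_zero)
  split_ifs with h
  · exact mul_nonpos_of_nonpos_of_nonneg (sub_nonpos.2 (hp1 m)) (sub_nonneg.2 (hS m h))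
  · rw [sub_zero]
    exact mul_nonpos_of_nonneg_of_nonpos (hp0 m) (sub_nonpos.2 (hS' m h))

theorem eq_indicator_of_bathtub_eq {l p : ℕ → ℝ} {S : Finset ℕ} {L c : ℝ} (hp0 : ∀ m, 0 ≤ p m)
    (hp1 : ∀ m, p m ≤ 1) (hp : HasSum p S.card) (hL : HasSum (fun m => p m * l m) L)
    (hS : ∀ m ∈ S, c < l m) (hS' : ∀ m ∉ S, l m < c) (h : L = ∑ m ∈ S, l m) (m : ℕ) :
    p m = if m ∈ S then 1 else 0 := by
  have h1 := (hasSum_bathtub c hp hL).neg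
  rw [h, sub_self, neg_zero, hasSum_zero_iff_of_nonneg] at h1
  · have h2 := congrFun h1 m
    simp only [Pi.zero_apply, neg_eq_zero, mul_eq_zero] at h2
    refine sub_eq_zero.1 (h2.resolve_right ?_)
    by_cases hm : m ∈ S
    · exact (sub_pos.2 (hS m hm)).ne'
    · exact (sub_neg.2 (hS' m hm)).ne
  · intro m
    refine neg_nonneg.2 ?_
    split_ifs with h
    · exact mul_nonpos_of_nonpos_of_nonneg (sub_nonpos.2 (hp1 m)) (sub_nonneg.2 (hS m h).le)
    · rw [sub_zero]
      exact mul_nonpos_of_nonneg_of_nonpos (hp0 m) (sub_nonpos.2 (hS' m h).le)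

/-- Weighted sums of the masses `poissonMass A m` with weights in `[0, 1]` of total `n` are
maximal for the interval and the weights concentrated on the first `n` indices. -/
theorem weighted_poissonMass_le {n : ℕ} (hn : 1 ≤ n) {s : ℝ} (hs : 0 < s) {A : Set ℝ}
    (hA : halfLine A = ENNReal.ofReal s) {p : ℕ → ℝ} {L : ℝ}
    (hp0 : ∀ m, 0 ≤ p m) (hp1 : ∀ m, p m ≤ 1) (hp : HasSum p n)
    (hL : HasSum (fun m => p m * poissonMass A m) L) :
    ∃ S : Finset ℕ, S.card = n ∧ L ≤ ∑ m ∈ S, poissonMass A m ∧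
      ∑ m ∈ S, poissonMass A m ≤ ∑ m ∈ Finset.range n, poissonMass (Iic s) m := by
  have hA0 : 0 < halfLine A := by rw [hA]; exact ENNReal.ofReal_pos.2 hs
  have hA' : halfLine A < ⊤ := by rw [hA]; exact ENNReal.ofReal_lt_top
  obtain ⟨S, rfl, hS⟩ := exists_finset_top (poissonMass_pos hA0) (tendsto_poissonMass hA') n
  obtain ⟨i, hi, hmin⟩ := Finset.exists_min_image S (poissonMass A) (Finset.card_pos.1 hn)
  refine ⟨S, rfl, bathtub_le hp0 hp1 hp hL hmin fun m hm => hS i hi m hm, ?_⟩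
  rw [sum_poissonMass, sum_poissonMass]
  exact setIntegral_poissonSum_le hn hs hA

theorem weighted_poissonMass_eq {n : ℕ} (hn : 1 ≤ n) {s : ℝ} (hs : 0 < s) {A : Set ℝ}
    (hAm : MeasurableSet A) (hA : halfLine A = ENNReal.ofReal s) {p : ℕ → ℝ}
    (hp0 : ∀ m, 0 ≤ p m) (hp1 : ∀ m, p m ≤ 1) (hp : HasSum p n)
    (hL : HasSum (fun m => p m * poissonMass A m)
      (∑ m ∈ Finset.range n, poissonMass (Iic s) m)) :
    A =ᵐ[halfLine] Iic s ∧ ∀ m, p m = if m < n then 1 else 0 := by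
  obtain ⟨S, hS, h1, h2⟩ := weighted_poissonMass_le hn hs hA hp0 hp1 hp hL
  have hae : A =ᵐ[halfLine] Iic s := by
    refine ae_eq_Iic_of_le (S := S) (hS ▸ hn) hs hAm hA ?_
    rw [sum_poissonMass, sum_poissonMass] at h1
    rwa [hS]
  refine ⟨hae, fun m => ?_⟩
  rw [poissonMass_congr hae] at hL
  have hanti := strictAnti_poissonMass_Iic hs
  have hlt : poissonMass (Iic s) n < poissonMass (Iic s) (n - 1) := hanti (by omega)
  -- With A known to be the interval, the optimal index set is range n, and the midpoint of two
  -- consecutive masses separates strictly.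
  have h := eq_indicator_of_bathtub_eq (S := Finset.range n) hp0 hp1 (by simpa using hp) hL
    (c := (poissonMass (Iic s) n + poissonMass (Iic s) (n - 1)) / 2)
    (fun m hm => ?_) (fun m hm => ?_) rfl m
  · simpa using h
  · rw [Finset.mem_range] at hm
    have := hanti.antitone (show m ≤ n - 1 by omega)
    linarith
  · rw [Finset.mem_range, not_lt] at hm
    have := hanti.antitone hm
    linarith

end Bathtub

/-! ### Radial sets and the push-forward of area. -/

section RadialMeasure

open Set Filter Topology

/-- The map `z ↦ π|z|²`. -/
noncomputable def areaRadius (z : ℂ) : ℝ := Real.pi * ‖z‖ ^ 2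

theorem areaRadius_nonneg (z : ℂ) : 0 ≤ areaRadius z := by
  unfold areaRadius; positivity

theorem continuous_areaRadius : Continuous areaRadius := by
  unfold areaRadius; fun_prop

theorem areaRadius_lt_iff {s : ℝ} {z : ℂ} :
    areaRadius z < s ↔ ‖z‖ < Real.sqrt (s / Real.pi) := by
  rw [Real.lt_sqrt (norm_nonneg z), lt_div_iff₀ Real.pi_pos, areaRadius, mul_comm]

theorem areaRadius_preimage_Iio (s : ℝ) :
    areaRadius ⁻¹' Iio s = Metric.ball 0 (Real.sqrt (s / Real.pi)) := by
  ext z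
  simp [areaRadius_lt_iff]

theorem areaRadius_preimage_Iio_sq {r : ℝ} (hr : 0 ≤ r) :
    areaRadius ⁻¹' Iio (Real.pi * r ^ 2) = Metric.ball 0 r := by
  rw [areaRadius_preimage_Iio, mul_div_cancel_left₀ _ Real.pi_ne_zero, Real.sqrt_sq hr]

theorem volume_areaRadius_preimage_Iio (s : ℝ) :
    volume (areaRadius ⁻¹' Iio s) = ENNReal.ofReal s := by
  rw [areaRadius_preimage_Iio, Complex.volume_ball]
  rcases le_total s 0 with h | h
  · rw [ENNReal.ofReal_of_nonpos h, Real.sqrt_eq_zero_of_nonpos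
      (div_nonpos_of_nonpos_of_nonneg h Real.pi_pos.le)]
    simp
  · rw [← ENNReal.ofReal_pow (Real.sqrt_nonneg _), Real.sq_sqrt (by positivity),
      ← NNReal.coe_real_pi, ← ENNReal.ofReal_coe_nnreal, ← ENNReal.ofReal_mul (by positivity)]
    congr 1
    exact div_mul_cancel₀ _ (by simp)

/-- The map `z ↦ π|z|²` pushes the area measure to Lebesgue measure on the half-line. -/
theorem measurePreserving_areaRadius : MeasurePreserving areaRadius volume halfLine := by
  refine ⟨continuous_areaRadius.measurable, ?_⟩
  have hIio : ∀ s, (volume.map areaRadius) (Iio s) = halfLine (Iio s) := fun s => by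
    rw [Measure.map_apply continuous_areaRadius.measurable measurableSet_Iio,
      volume_areaRadius_preimage_Iio, Measure.restrict_apply measurableSet_Iio, inter_comm,
      Ioi_inter_Iio, Real.volume_Ioo, sub_zero]
  refine Measure.ext_of_generateFrom_of_iUnion (range Iio) (fun n : ℕ => Iio (n : ℝ))
    (borel_eq_generateFrom_Iio ℝ ▸ BorelSpace.measurable_eq) isPiSystem_Iio ?_ ?_ ?_ ?_
  · exact iUnion_eq_univ_iff.2 fun x => exists_nat_gt x
  · exact fun n => ⟨n, rfl⟩
  · intro n
    rw [Measure.map_apply continuous_areaRadius.measurable measurableSet_Iio,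
      volume_areaRadius_preimage_Iio]
    exact ENNReal.ofReal_ne_top
  · rintro _ ⟨s, rfl⟩
    exact hIio s

theorem MeasureTheory.MeasurePreserving.preimage_ae_eq_iff {α β : Type*} [MeasurableSpace α]
    [MeasurableSpace β] {μ : Measure α} {ν : Measure β} {f : α → β} (hf : MeasurePreserving f μ ν)
    {A B : Set β} (hA : MeasurableSet A) (hB : MeasurableSet B) :
    f ⁻¹' A =ᵐ[μ] f ⁻¹' B ↔ A =ᵐ[ν] B := by
  rw [← measure_symmDiff_eq_zero_iff, ← measure_symmDiff_eq_zero_iff, ← preimage_symmDiff,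
    hf.measure_preimage (hA.symmDiff hB).nullMeasurableSet]

end RadialMeasure

/-! ### Parseval on the unit circle. -/

section CircleParseval

open Set Filter Topology

/-- The partial sums are polynomials, for which Parseval is known; they are bounded by Σ‖a_m‖, so
dominated convergence passes to the limit. -/
theorem hasSum_sq_norm_circle {a : ℕ → ℂ} (ha : Summable fun m => ‖a m‖) {f : ℝ → ℂ}
    (hf : ∀ θ : ℝ, HasSum (fun m => a m * circleMap 0 1 θ ^ m) (f θ)) :
    HasSum (fun m => 2 * Real.pi * ‖a m‖ ^ 2) (∫ θ in 0..2 * Real.pi, ‖f θ‖ ^ 2) := by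
  rw [hasSum_iff_tendsto_nat_of_nonneg fun m => by positivity]
  have hnorm : ∀ (N : ℕ) (θ : ℝ), ‖∑ m ∈ Finset.range N, a m * circleMap 0 1 θ ^ m‖ ≤
      ∑' m, ‖a m‖ := fun N θ => by
    refine (norm_sum_le _ _).trans ?_
    simp only [norm_mul, norm_pow, norm_circleMap_zero, abs_one, one_pow, mul_one]
    exact ha.sum_le_tsum _ fun _ _ => norm_nonneg _
  have h := intervalIntegral.tendsto_integral_filter_of_dominated_convergence
    (μ := volume) (a := 0) (b := 2 * Real.pi) (l := atTop)
    (F := fun (N : ℕ) θ => ‖∑ m ∈ Finset.range N, a m * circleMap 0 1 θ ^ m‖ ^ 2)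
    (f := fun θ => ‖f θ‖ ^ 2) (fun _ => (∑' m, ‖a m‖) ^ 2)
    (.of_forall fun N => by fun_prop)
    (.of_forall fun N => .of_forall fun θ _ => by
      rw [Real.norm_of_nonneg (by positivity)]
      exact pow_le_pow_left₀ (norm_nonneg _) (hnorm N θ) 2)
    intervalIntegrable_const
    (.of_forall fun θ _ => ((hf θ).tendsto_sum_nat.norm.pow 2))
  refine h.congr fun N => ?_
  set P : Polynomial ℂ := ∑ m ∈ Finset.range N, Polynomial.monomial m (a m) with hP
  have hcoeff : ∀ m, P.coeff m = if m < N then a m else 0 := fun m => by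
    simp [hP, Polynomial.coeff_monomial]
  have heval : ∀ z, P.eval z = ∑ m ∈ Finset.range N, a m * z ^ m := fun z => by
    simp [hP, Polynomial.eval_finsetSum]
  have h1 := P.sum_sq_norm_coeff_eq_circleAverage
  rw [Real.circleAverage, smul_eq_mul] at h1
  simp only [heval] at h1
  rw [← Finset.mul_sum]
  have h2 : ∑ m ∈ P.support, ‖P.coeff m‖ ^ 2 = ∑ m ∈ Finset.range N, ‖a m‖ ^ 2 := by
    rw [Finset.sum_subset (s₂ := Finset.range N)]
    · refine Finset.sum_congr rfl fun m hm => ?_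
      rw [hcoeff, if_pos (Finset.mem_range.1 hm)]
    · intro m hm
      rw [Polynomial.mem_support_iff, hcoeff] at hm
      exact Finset.mem_range.2 (by by_contra h; simp [h] at hm)
    · intro m _ hm
      rw [Polynomial.notMem_support_iff.1 hm]
      simp
  rw [← h2, h1]
  have := Real.pi_pos
  field_simp

end CircleParseval

/-! ### Taylor coefficients and integrals over radial sets. -/

namespace FockSpace

open Set Filter Topology

/-- The coefficient of `e_m` in the expansion of `G` in normalized monomials. -/
noncomputable def coeff (m : ℕ) (G : FockSpace) : ℂ :=
  ((Real.sqrt (m.factorial : ℝ) : ℝ) : ℂ) / ((Real.sqrt (Real.pi ^ m) : ℝ) : ℂ) *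
    ((m.factorial : ℂ)⁻¹ * iteratedDeriv m G 0)

theorem monomial_apply (m : ℕ) (z : ℂ) : monomial m z =
    ((Real.sqrt (Real.pi ^ m) : ℝ) : ℂ) * z ^ m / ((Real.sqrt (m.factorial : ℝ) : ℝ) : ℂ) := rfl

theorem sqrt_factorial_ne_zero (m : ℕ) : ((Real.sqrt (m.factorial : ℝ) : ℝ) : ℂ) ≠ 0 :=
  Complex.ofReal_ne_zero.2 (Real.sqrt_pos.2 (by positivity)).ne'

theorem sqrt_pi_pow_ne_zero (m : ℕ) : ((Real.sqrt (Real.pi ^ m) : ℝ) : ℂ) ≠ 0 :=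
  Complex.ofReal_ne_zero.2 (Real.sqrt_pos.2 (pow_pos Real.pi_pos m)).ne'

theorem coeff_mul_monomial (m : ℕ) (G : FockSpace) (z : ℂ) :
    coeff m G * monomial m z = (m.factorial : ℂ)⁻¹ * iteratedDeriv m G 0 * z ^ m := by
  have h1 := sqrt_factorial_ne_zero m
  have h2 := sqrt_pi_pow_ne_zero m
  rw [coeff, monomial_apply]
  field_simp

theorem hasSum_coeff_mul_monomial (G : FockSpace) (z : ℂ) :
    HasSum (fun m => coeff m G * monomial m z) (G z) := by
  have h := Complex.hasSum_taylorSeries_of_entire G.differentiable 0 z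
  refine h.congr_fun fun m => ?_
  rw [coeff_mul_monomial, smul_eq_mul, smul_eq_mul, sub_zero]
  ring

theorem summable_norm_coeff_mul_monomial (G : FockSpace) (z : ℂ) :
    Summable fun m => ‖coeff m G * monomial m z‖ :=
  (hasSum_coeff_mul_monomial G z).summable.norm

theorem contDiffAt (G : FockSpace) (n : WithTop ℕ∞) (z : ℂ) : ContDiffAt ℂ n G z :=
  G.differentiable.contDiff.contDiffAt

theorem coeff_add (m : ℕ) (G H : FockSpace) : coeff m (G + H) = coeff m G + coeff m H := by
  have : iteratedDeriv m (G + H).1 0 = iteratedDeriv m G.1 0 + iteratedDeriv m H.1 0 :=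
    iteratedDeriv_add (G.contDiffAt m 0) (H.contDiffAt m 0)
  rw [coeff, this, coeff, coeff]
  ring

theorem coeff_smul (m : ℕ) (c : ℂ) (G : FockSpace) : coeff m (c • G) = c * coeff m G := by
  have : iteratedDeriv m (c • G).1 0 = c • iteratedDeriv m G.1 0 :=
    iteratedDeriv_const_smul (G.contDiffAt m 0) c
  rw [coeff, this, coeff, smul_eq_mul]
  ring

theorem coeff_monomial (m k : ℕ) : coeff m (monomial k) = if m = k then 1 else 0 := by
  have h : (monomial k).1 = fun z : ℂ => (((Real.sqrt (Real.pi ^ k) : ℝ) : ℂ) /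
      ((Real.sqrt (k.factorial : ℝ) : ℝ) : ℂ)) * z ^ k := by
    funext z
    exact (monomial_apply k z).trans (by ring)
  have h1 := sqrt_factorial_ne_zero k
  have h2 := sqrt_pi_pow_ne_zero k
  have h3 : (k.factorial : ℂ) ≠ 0 := by exact_mod_cast k.factorial_ne_zero
  rw [coeff, h, iteratedDeriv_const_mul_field, iteratedDeriv_fun_pow_zero]
  split_ifs with hmk
  · subst hmk
    field_simp
  · simp

theorem norm_monomial_sq_mul_fockWeight (m : ℕ) (z : ℂ) :
    ‖monomial m z‖ ^ 2 * fockWeight z = poissonWeight m (areaRadius z) := by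
  rw [monomial_apply, fockWeight, poissonWeight, areaRadius, norm_div, norm_mul, norm_pow,
    Complex.norm_real, Complex.norm_real, Real.norm_of_nonneg (Real.sqrt_nonneg _),
    Real.norm_of_nonneg (Real.sqrt_nonneg _), div_pow, mul_pow, Real.sq_sqrt (by positivity),
    Real.sq_sqrt (by positivity)]
  ring

theorem monomial_mul_circleMap (m : ℕ) (z : ℂ) (θ : ℝ) :
    monomial m (circleMap 0 1 θ * z) = monomial m z * circleMap 0 1 θ ^ m := by
  rw [monomial_apply, monomial_apply, mul_pow]
  ring

theorem areaRadius_circleMap_mul (z : ℂ) (θ : ℝ) :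
    areaRadius (circleMap 0 1 θ * z) = areaRadius z := by
  simp [areaRadius]

theorem fockWeight_eq (z : ℂ) : fockWeight z = Real.exp (-areaRadius z) := rfl

theorem hasSum_circle (G : FockSpace) (z : ℂ) :
    HasSum (fun m => 2 * Real.pi * (‖coeff m G‖ ^ 2 * poissonWeight m (areaRadius z)))
      (∫ θ in 0..2 * Real.pi, ‖G (circleMap 0 1 θ * z)‖ ^ 2 * fockWeight (circleMap 0 1 θ * z)) := by
  have h := (hasSum_sq_norm_circle (summable_norm_coeff_mul_monomial G z)
    (f := fun θ => G (circleMap 0 1 θ * z)) fun θ => by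
      have := hasSum_coeff_mul_monomial G (circleMap 0 1 θ * z)
      simpa only [monomial_mul_circleMap, ← mul_assoc] using this).mul_right (fockWeight z)
  simp only [fockWeight_eq, areaRadius_circleMap_mul]
  rw [intervalIntegral.integral_mul_const]
  refine h.congr_fun fun m => ?_
  rw [← norm_monomial_sq_mul_fockWeight, norm_mul]
  ring

/-- A radial set is rotation invariant, so the integrand may be averaged over rotations. Tonelli
puts the angular integral inside, where Parseval diagonalizes it, and the push-forward turns each
term into an integral over A. Lower integrals avoid all summability questions. -/
theorem setLIntegral_areaRadius_preimage (G : FockSpace) {A : Set ℝ} (hA : MeasurableSet A) :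
    ∫⁻ z in areaRadius ⁻¹' A, ENNReal.ofReal (‖G z‖ ^ 2 * fockWeight z) =
      ∑' m, ∫⁻ t in A, ENNReal.ofReal (‖coeff m G‖ ^ 2 * poissonWeight m t) ∂halfLine := by
  set Ω := areaRadius ⁻¹' A with hΩ
  have hΩm : MeasurableSet Ω := continuous_areaRadius.measurable hA
  have hc : Continuous fun z => ‖G z‖ ^ 2 * fockWeight z :=
    (G.differentiable.continuous.norm.pow 2).mul continuous_fockWeight
  have hc2 : Continuous fun p : ℝ × ℂ => ‖G (circleMap 0 1 p.1 * p.2)‖ ^ 2 *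
      fockWeight (circleMap 0 1 p.1 * p.2) := hc.comp
    (((continuous_circleMap 0 1).comp continuous_fst).mul continuous_snd)
  have hrot : ∀ θ : ℝ, ∫⁻ z in Ω, ENNReal.ofReal (‖G (circleMap 0 1 θ * z)‖ ^ 2 *
      fockWeight (circleMap 0 1 θ * z)) = ∫⁻ z in Ω, ENNReal.ofReal (‖G z‖ ^ 2 * fockWeight z) := by
    intro θ
    have hr : ∀ z, rotation (Circle.exp θ) z = circleMap 0 1 θ * z := fun z => by
      simp [circleMap, Circle.coe_exp]
    have h := (rotation (Circle.exp θ)).measurePreserving.setLIntegral_comp_preimage hΩm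
      (f := fun z => ENNReal.ofReal (‖G z‖ ^ 2 * fockWeight z)) hc.measurable.ennreal_ofReal
    have hpre : (rotation (Circle.exp θ)) ⁻¹' Ω = Ω := by
      ext z
      simp only [hΩ, mem_preimage, hr, areaRadius_circleMap_mul]
    rw [hpre] at h
    simpa only [hr] using h
  have hpi : (0 : ℝ) ≤ 2 * Real.pi := by have := Real.pi_pos; positivity
  have h1 : ENNReal.ofReal (2 * Real.pi) * ∫⁻ z in Ω, ENNReal.ofReal (‖G z‖ ^ 2 * fockWeight z) =
      ∫⁻ θ in Ioc 0 (2 * Real.pi), ∫⁻ z in Ω, ENNReal.ofReal (‖G (circleMap 0 1 θ * z)‖ ^ 2 *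
        fockWeight (circleMap 0 1 θ * z)) := by
    simp only [hrot]
    rw [setLIntegral_const, Real.volume_Ioc, sub_zero, mul_comm]
  have h2 : ∀ z, ∫⁻ θ in Ioc 0 (2 * Real.pi), ENNReal.ofReal (‖G (circleMap 0 1 θ * z)‖ ^ 2 *
        fockWeight (circleMap 0 1 θ * z)) = ENNReal.ofReal (2 * Real.pi) *
        ∑' m, ENNReal.ofReal (‖coeff m G‖ ^ 2 * poissonWeight m (areaRadius z)) := by
    intro z
    have hcz : Continuous fun θ => ‖G (circleMap 0 1 θ * z)‖ ^ 2 *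
        fockWeight (circleMap 0 1 θ * z) := 
      hc.comp ((continuous_circleMap 0 1).mul continuous_const)
    have hnn : ∀ m, 0 ≤ ‖coeff m G‖ ^ 2 * poissonWeight m (areaRadius z) := fun m =>
      mul_nonneg (sq_nonneg _) (poissonWeight_nonneg m (areaRadius_nonneg z))
    rw [← ofReal_integral_eq_lintegral_ofReal
      hcz.integrableOn_Ioc
      (.of_forall fun θ => mul_nonneg (sq_nonneg _) (fockWeight_pos _).le),
      ← intervalIntegral.integral_of_le hpi, ← (hasSum_circle G z).tsum_eq,
      ENNReal.ofReal_tsum_of_nonneg (fun m => mul_nonneg hpi (hnn m)) (hasSum_circle G z).summable,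
      ← ENNReal.tsum_mul_left]
    simp only [ENNReal.ofReal_mul hpi]
  rw [lintegral_lintegral_swap hc2.measurable.ennreal_ofReal.aemeasurable] at h1
  simp only [h2] at h1
  have hm : ∀ m, Measurable fun t => ENNReal.ofReal (‖coeff m G‖ ^ 2 * poissonWeight m t) :=
    fun m => by
      have := continuous_poissonWeight m
      fun_prop
  have hmz : ∀ m, Measurable fun z =>
      ENNReal.ofReal (‖coeff m G‖ ^ 2 * poissonWeight m (areaRadius z)) :=
    fun m => (hm m).comp continuous_areaRadius.measurable
  rw [lintegral_const_mul _ (Measurable.tsum hmz)] at h1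
  have h3 := (ENNReal.mul_right_inj (ENNReal.ofReal_pos.2 Real.two_pi_pos).ne'
    ENNReal.ofReal_ne_top).1 h1
  rw [h3, lintegral_tsum fun m => (hmz m).aemeasurable]
  congr 1
  funext m
  exact measurePreserving_areaRadius.setLIntegral_comp_preimage hA (hm m)

theorem hasSum_setIntegral (G : FockSpace) {A : Set ℝ} (hA : MeasurableSet A) :
    HasSum (fun m => ‖coeff m G‖ ^ 2 * poissonMass A m)
      (∫ z in areaRadius ⁻¹' A, ‖G z‖ ^ 2 * fockWeight z) := by
  have h := setLIntegral_areaRadius_preimage G hA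
  have h1 : ∀ m, ∫⁻ t in A, ENNReal.ofReal (‖coeff m G‖ ^ 2 * poissonWeight m t) ∂halfLine =
      ENNReal.ofReal (‖coeff m G‖ ^ 2 * poissonMass A m) := fun m => by
    rw [poissonMass, ← integral_const_mul, ofReal_integral_eq_lintegral_ofReal
      ((integrable_poissonWeight m).integrableOn.const_mul _)]
    refine ae_restrict_of_ae ?_
    filter_upwards [ae_halfLine_pos] with t ht
    exact mul_nonneg (sq_nonneg _) (poissonWeight_nonneg m ht.le)
  have hnn : ∀ m, 0 ≤ ‖coeff m G‖ ^ 2 * poissonMass A m := fun m =>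
    mul_nonneg (sq_nonneg _) (poissonMass_nonneg A m)
  rw [← ofReal_integral_eq_lintegral_ofReal G.integrable_sq.integrableOn
    (.of_forall fun z => mul_nonneg (sq_nonneg _) (fockWeight_pos _).le)] at h
  simp only [h1] at h
  have hs : Summable fun m => ‖coeff m G‖ ^ 2 * poissonMass A m := by
    have hne : ∑' m, ENNReal.ofReal (‖coeff m G‖ ^ 2 * poissonMass A m) ≠ ⊤ :=
      h ▸ ENNReal.ofReal_ne_top
    refine (ENNReal.summable_toReal hne).congr fun m => ?_
    rw [ENNReal.toReal_ofReal (hnn m)]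
  rw [← ENNReal.ofReal_tsum_of_nonneg hnn hs, ENNReal.ofReal_eq_ofReal_iff
    (integral_nonneg fun z => mul_nonneg (sq_nonneg _) (fockWeight_pos _).le) (tsum_nonneg hnn)] at h
  rw [h]
  exact hs.hasSum

end FockSpace

/-! ### Parseval in the Fock space and occupation numbers. -/

namespace FockSpace

theorem poissonMass_univ (m : ℕ) : poissonMass Set.univ m = 1 := by
  have h := Real.Gamma_eq_integral (s := (m : ℝ) + 1) (by positivity)
  rw [Real.Gamma_nat_eq_factorial] at h
  have h1 : poissonMass Set.univ m = (∫ x in Set.Ioi 0, Real.exp (-x) * x ^ ((m : ℝ) + 1 - 1)) /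
      (m.factorial : ℝ) := by
    rw [poissonMass, Measure.restrict_univ, ← integral_div]
    congr 1
    funext t
    rw [add_sub_cancel_right, Real.rpow_natCast, poissonWeight]
    ring
  rw [h1, ← h, div_self (by positivity)]

/-- This is the radial formula on the whole plane, where every Poisson weight has mass 1. -/
theorem hasSum_norm_sq_coeff (G : FockSpace) : HasSum (fun m => ‖coeff m G‖ ^ 2) (‖G‖ ^ 2) := by
  have h := hasSum_setIntegral G MeasurableSet.univ
  rw [Set.preimage_univ, Measure.restrict_univ, ← norm_sq_def] at h
  simpa only [poissonMass_univ, mul_one] using h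

/-- The expansion in normalized monomials as an isometry from the Fock space to `ℓ²`. -/
noncomputable def coeffIsometry : FockSpace →ₗᵢ[ℂ] lp (fun _ : ℕ => ℂ) 2 where
  toFun G := ⟨fun m => coeff m G, memℓp_gen (by
    simpa using (hasSum_norm_sq_coeff G).summable)⟩
  map_add' F G := lp.ext (funext fun m => coeff_add m F G)
  map_smul' c G := lp.ext (funext fun m => coeff_smul m c G)
  norm_map' G := by
    have h1 := lp.norm_rpow_eq_tsum (p := 2) (by norm_num) (⟨fun m => coeff m G, memℓp_gen (by
      simpa using (hasSum_norm_sq_coeff G).summable)⟩ : lp (fun _ : ℕ => ℂ) 2)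
    simp only [ENNReal.toReal_ofNat, Real.rpow_two] at h1
    rw [(hasSum_norm_sq_coeff G).tsum_eq] at h1
    exact (sq_eq_sq₀ (norm_nonneg _) (norm_nonneg _)).1 h1

theorem hasSum_inner (F G : FockSpace) :
    HasSum (fun m => coeff m G * conj (coeff m F)) (inner ℂ F G) := by
  rw [← coeffIsometry.inner_map_map]
  exact lp.hasSum_inner (coeffIsometry F) (coeffIsometry G)

theorem inner_monomial_left (m : ℕ) (G : FockSpace) : inner ℂ (monomial m) G = coeff m G := by
  refine (hasSum_inner (monomial m) G).unique ?_
  convert hasSum_ite_eq m (coeff m G) using 2 with k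
  rw [coeff_monomial]
  split_ifs with h
  · simp [h]
  · simp

theorem norm_monomial (m : ℕ) : ‖monomial m‖ = 1 := by
  have h := congrArg Complex.re (inner_monomial_left m (monomial m))
  rw [coeff_monomial, if_pos rfl, Complex.one_re] at h
  have h1 : ‖monomial m‖ ^ 2 = 1 := (norm_sq_eq_re_inner (𝕜 := ℂ) (monomial m)).trans h
  exact (pow_eq_one_iff_of_nonneg (norm_nonneg _) two_ne_zero).1 h1

theorem sum_apply {ι : Type*} (s : Finset ι) (f : ι → FockSpace) (z : ℂ) :
    (∑ i ∈ s, f i) z = ∑ i ∈ s, f i z :=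
  map_sum (⟨⟨fun F : FockSpace => F z, rfl⟩, fun _ _ => rfl⟩ : FockSpace →+ ℂ) f s

theorem coeff_sum_smul_monomial {n : ℕ} (c : Fin n → ℂ) (m : ℕ) :
    coeff m (∑ i : Fin n, c i • monomial i) = if h : m < n then c ⟨m, h⟩ else 0 := by
  rw [← inner_monomial_left, inner_sum]
  simp only [inner_smul_right, inner_monomial_left, coeff_monomial, mul_ite, mul_one, mul_zero]
  split_ifs with h
  · rw [Finset.sum_eq_single (⟨m, h⟩ : Fin n)]
    · simp
    · intro b _ hb
      exact if_neg fun hm => hb (Fin.ext hm.symm)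
    · simp
  · exact Finset.sum_eq_zero fun i _ => if_neg fun hm : m = i => h (hm ▸ i.2)

theorem eq_sum_smul_monomial {n : ℕ} {G : FockSpace} (h : ∀ m, n ≤ m → coeff m G = 0) :
    G = ∑ i : Fin n, coeff (i : ℕ) G • monomial i := by
  have hinj : ∀ H : FockSpace, (∀ m, coeff m H = coeff m G) → G = H := fun H hH =>
    ext fun z => (hasSum_coeff_mul_monomial G z).unique (by
      simpa only [hH] using hasSum_coeff_mul_monomial H z)
  refine hinj _ fun m => ?_
  rw [coeff_sum_smul_monomial]
  split_ifs with hm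
  · rfl
  · exact (h m (not_lt.1 hm)).symm

/-- The total energy that a family puts on the `m`-th normalized monomial. -/
noncomputable def occupation {n : ℕ} (G : Fin n → FockSpace) (m : ℕ) : ℝ :=
  ∑ k, ‖coeff m (G k)‖ ^ 2

theorem occupation_nonneg {n : ℕ} (G : Fin n → FockSpace) (m : ℕ) : 0 ≤ occupation G m :=
  Finset.sum_nonneg fun _ _ => sq_nonneg _

/-- Bessel's inequality for the unit vector e_m against the family G. -/
theorem occupation_le_one {n : ℕ} {G : Fin n → FockSpace} (hG : Orthonormal ℂ G) (m : ℕ) :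
    occupation G m ≤ 1 := by
  have h := hG.sum_inner_products_le (monomial m) (s := Finset.univ)
  rw [norm_monomial, one_pow] at h
  refine le_trans (le_of_eq (Finset.sum_congr rfl fun k _ => ?_)) h
  rw [← inner_monomial_left, norm_inner_symm]

theorem hasSum_occupation {n : ℕ} {G : Fin n → FockSpace} (hG : Orthonormal ℂ G) :
    HasSum (occupation G) n := by
  have h := hasSum_sum (s := Finset.univ) fun k (_ : k ∈ Finset.univ) =>
    hasSum_norm_sq_coeff (G k)
  simp only [hG.1, one_pow, Finset.sum_const, Finset.card_univ, Fintype.card_fin, nsmul_eq_mul,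
    mul_one] at h
  exact h

theorem hasSum_occupation_mul_poissonMass {n : ℕ} (G : Fin n → FockSpace) {A : Set ℝ}
    (hA : MeasurableSet A) :
    HasSum (fun m => occupation G m * poissonMass A m)
      (∑ k, ∫ z in areaRadius ⁻¹' A, ‖G k z‖ ^ 2 * fockWeight z) := by
  have h := hasSum_sum (s := Finset.univ) fun k (_ : k ∈ Finset.univ) =>
    hasSum_setIntegral (G k) hA
  simpa only [occupation, Finset.sum_mul] using h

/-- Forward, the columns of U have norm 1. Backward, vanishing occupation from n on puts each G_k in
the span of e_0, …, e_{n-1}, and orthonormality of the family says that the rows of its coefficient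
matrix are orthonormal. -/
theorem exists_unitary_iff_occupation {n : ℕ} {G : Fin n → FockSpace} (hG : Orthonormal ℂ G) :
    (∃ U ∈ Matrix.unitaryGroup (Fin n) ℂ, ∀ k, G k = ∑ i : Fin n, U k i • monomial i) ↔
      ∀ m, occupation G m = if m < n then 1 else 0 := by
  constructor
  · rintro ⟨U, hU, h⟩ m
    simp only [occupation, h, coeff_sum_smul_monomial]
    split_ifs with hm
    · have h1 := congrFun (congrFun (Matrix.mem_unitaryGroup_iff'.1 hU) ⟨m, hm⟩) ⟨m, hm⟩
      rw [Matrix.mul_apply, Matrix.one_apply_eq] at h1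
      have h2 : ∀ k, (star U) ⟨m, hm⟩ k * U k ⟨m, hm⟩ = ((‖U k ⟨m, hm⟩‖ ^ 2 : ℝ) : ℂ) := fun k => by
        rw [Matrix.star_apply, RCLike.star_def, Complex.conj_mul']
        push_cast
        rfl
      simp only [h2] at h1
      exact_mod_cast h1
    · simp
  · intro h
    have h0 : ∀ m, n ≤ m → ∀ k, coeff m (G k) = 0 := fun m hm k => by
      have h1 := h m
      rw [if_neg (not_lt.2 hm), occupation, Finset.sum_eq_zero_iff_of_nonneg
        fun _ _ => sq_nonneg _] at h1
      simpa using h1 k (Finset.mem_univ k)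
    refine ⟨Matrix.of fun k i => coeff (i : ℕ) (G k), ?_,
      fun k => eq_sum_smul_monomial fun m hm => h0 m hm k⟩
    rw [Matrix.mem_unitaryGroup_iff]
    ext k l
    have h1 := hasSum_inner (G l) (G k)
    have h2 := hasSum_sum_of_ne_finset_zero (L := .unconditional ℕ) (s := Finset.range n)
      (f := fun m => coeff m (G k) * conj (coeff m (G l))) fun m hm => by
        rw [h0 m (by simpa using hm) k, zero_mul]
    rw [Matrix.mul_apply]
    simp only [Matrix.star_apply, Matrix.of_apply, RCLike.star_def]
    rw [Fin.sum_univ_eq_sum_range fun m => coeff m (G k) * conj (coeff m (G l)), ← h1.unique h2,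
      orthonormal_iff_ite.1 hG l k, Matrix.one_apply]
    simp only [eq_comm]

end FockSpace

/-! ### Concentration on radial sets and translation to the centre w. -/

section Concentration

open FockSpace Filter

/-- Concentration of an orthonormal family on a set that is radial around the origin. -/
theorem sum_concentration_le {n : ℕ} (hn : 1 ≤ n) {G : Fin n → FockSpace} (hG : Orthonormal ℂ G)
    {A : Set ℝ} (hAm : MeasurableSet A) {s : ℝ} (hs : 0 < s)
    (hA : halfLine A = ENNReal.ofReal s) :
    ∑ k, ∫ z in areaRadius ⁻¹' A, ‖G k z‖ ^ 2 * fockWeight z ≤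
      ∑ m ∈ Finset.range n, poissonMass (Set.Iic s) m := by
  obtain ⟨S, -, h1, h2⟩ := weighted_poissonMass_le hn hs hA (occupation_nonneg G)
    (occupation_le_one hG) (hasSum_occupation hG) (hasSum_occupation_mul_poissonMass G hAm)
  exact h1.trans h2

theorem sum_concentration_eq_iff {n : ℕ} (hn : 1 ≤ n) {G : Fin n → FockSpace}
    (hG : Orthonormal ℂ G) {A : Set ℝ} (hAm : MeasurableSet A) {s : ℝ} (hs : 0 < s)
    (hA : halfLine A = ENNReal.ofReal s) :
    ∑ k, ∫ z in areaRadius ⁻¹' A, ‖G k z‖ ^ 2 * fockWeight z =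
        ∑ m ∈ Finset.range n, poissonMass (Set.Iic s) m ↔
      A =ᵐ[halfLine] Set.Iic s ∧
        ∃ U ∈ Matrix.unitaryGroup (Fin n) ℂ, ∀ k, G k = ∑ i : Fin n, U k i • monomial i := by
  have hL := hasSum_occupation_mul_poissonMass G hAm
  rw [exists_unitary_iff_occupation hG]
  constructor
  · intro h
    rw [h] at hL
    exact weighted_poissonMass_eq hn hs hAm hA (occupation_nonneg G) (occupation_le_one hG)
      (hasSum_occupation hG) hL
  · rintro ⟨hAe, hocc⟩
    rw [poissonMass_congr hAe] at hL
    refine hL.unique ?_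
    have h := hasSum_sum_of_ne_finset_zero (L := .unconditional ℕ) (s := Finset.range n)
      (f := fun m => occupation G m * poissonMass (Set.Iic s) m) fun m hm => by
        rw [hocc, if_neg (by simpa using hm), zero_mul]
    rwa [Finset.sum_congr rfl fun m hm => by
      rw [hocc, if_pos (Finset.mem_range.1 hm), one_mul]] at h

theorem areaRadius_sub_preimage_Iio {r : ℝ} (hr : 0 ≤ r) (w : ℂ) :
    (fun z => areaRadius (z - w)) ⁻¹' Set.Iio (Real.pi * r ^ 2) = Metric.ball w r := by
  ext z
  have := Set.ext_iff.1 (areaRadius_preimage_Iio_sq hr) (z - w)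
  simpa [dist_eq_norm] using this

theorem measurePreserving_areaRadius_sub (w : ℂ) :
    MeasurePreserving (fun z => areaRadius (z - w)) volume halfLine :=
  measurePreserving_areaRadius.comp (measurePreserving_sub_right volume w)

theorem ae_eq_ball_iff {A : Set ℝ} (hAm : MeasurableSet A) {s : ℝ} (hs : 0 < s)
    (hA : halfLine A = ENNReal.ofReal s) (w : ℂ) :
    (∃ r : ℝ, 0 < r ∧ (fun z => areaRadius (z - w)) ⁻¹' A =ᵐ[volume] Metric.ball w r) ↔
      A =ᵐ[halfLine] Set.Iic s := by
  have hIio : ∀ t : ℝ, (Set.Iio t : Set ℝ) =ᵐ[halfLine] Set.Iic t := fun t =>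
    ae_restrict_of_ae Iio_ae_eq_Iic
  have key : ∀ r : ℝ, 0 ≤ r → ((fun z => areaRadius (z - w)) ⁻¹' A =ᵐ[volume] Metric.ball w r ↔
      A =ᵐ[halfLine] Set.Iio (Real.pi * r ^ 2)) := fun r hr => by
    rw [← areaRadius_sub_preimage_Iio hr,
      (measurePreserving_areaRadius_sub w).preimage_ae_eq_iff hAm measurableSet_Iio]
  constructor
  · rintro ⟨r, hr, h⟩
    have h1 := (key r hr.le).1 h
    -- Comparing lengths forces πr² = s, so the radius of the ball is determined.
    have h2 := measure_congr (h1.trans (hIio _))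
    rw [hA, halfLine_Iic, ENNReal.ofReal_eq_ofReal_iff hs.le (by positivity)] at h2
    exact h2 ▸ h1.trans (hIio _)
  · intro h
    refine ⟨Real.sqrt (s / Real.pi), by positivity, (key _ (Real.sqrt_nonneg _)).2 ?_⟩
    rw [Real.sq_sqrt (by positivity), mul_div_cancel₀ _ Real.pi_ne_zero]
    exact h.trans (hIio s).symm

theorem HasCircularSymmetry.exists_preimage {Ω : Set ℂ} {w : ℂ} (h : HasCircularSymmetry Ω w) :
    ∃ A : Set ℝ, MeasurableSet A ∧ Ω = (fun z => areaRadius (z - w)) ⁻¹' A := by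
  obtain ⟨E, hE, -, rfl⟩ := h
  refine ⟨(fun t => Real.sqrt (t / Real.pi)) ⁻¹' E, ?_, ?_⟩
  · exact (by fun_prop : Measurable fun t : ℝ => Real.sqrt (t / Real.pi)) hE
  · ext z
    simp only [Set.mem_preimage, Set.mem_ofPred_eq, areaRadius,
      mul_div_cancel_left₀ _ Real.pi_ne_zero, Real.sqrt_sq (norm_nonneg _)]

theorem setIntegral_shift (w : ℂ) (G : FockSpace) {A : Set ℝ} (hA : MeasurableSet A) :
    ∫ z in (fun z => areaRadius (z - w)) ⁻¹' A, ‖shift w G z‖ ^ 2 * fockWeight z =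
      ∫ z in areaRadius ⁻¹' A, ‖G z‖ ^ 2 * fockWeight z := by
  have h := (measurePreserving_sub_right volume w).setIntegral_preimage_emb
    (MeasurableEquiv.subRight w).measurableEmbedding (fun z => ‖G z‖ ^ 2 * fockWeight z)
    (areaRadius ⁻¹' A)
  rw [← h]
  refine setIntegral_congr_fun ?_ fun z _ => ?_
  · exact (measurePreserving_areaRadius_sub w).measurable hA
  · change ‖shiftFun w G z‖ ^ 2 * fockWeight z = _
    simp only [shiftFun_apply, norm_mul]
    rw [← norm_exp_sq_mul_fockWeight w z]
    ring

end Concentration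

theorem theorem1p3 (Ω : Set ℂ) (w : ℂ) (hΩ : HasCircularSymmetry Ω w)
    (hpos : 0 < volume Ω) (hfin : volume Ω < ⊤)
    (n : ℕ) (hn : 1 ≤ n) (F : Fin n → FockSpace) (hF : Orthonormal ℂ F) :
    ((∑ k : Fin n, ∫ z in Ω, ‖F k z‖ ^ 2 * Real.exp (-(Real.pi * ‖z‖ ^ 2))) ≤
      (n : ℝ) - ∑ k ∈ Finset.range n, ((n : ℝ) - (k : ℝ)) *
        ((volume Ω).toReal ^ k / (k.factorial : ℝ)) * Real.exp (-(volume Ω).toReal)) ∧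
    (((∑ k : Fin n, ∫ z in Ω, ‖F k z‖ ^ 2 * Real.exp (-(Real.pi * ‖z‖ ^ 2))) =
      (n : ℝ) - ∑ k ∈ Finset.range n, ((n : ℝ) - (k : ℝ)) *
        ((volume Ω).toReal ^ k / (k.factorial : ℝ)) * Real.exp (-(volume Ω).toReal)) ↔
      (∃ r : ℝ, 0 < r ∧ Ω =ᵐ[volume] Metric.ball w r) ∧
      ∃ U ∈ Matrix.unitaryGroup (Fin n) ℂ, ∀ z : ℂ,
        (fun k : Fin n => F k z) =
          U *ᵥ (fun k : Fin n => FockSpace.shift w (FockSpace.monomial (k : ℕ)) z)) := by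
  obtain ⟨A, hAm, rfl⟩ := hΩ.exists_preimage
  set Ω := (fun z => areaRadius (z - w)) ⁻¹' A with hΩ_def
  set s := (volume Ω).toReal with hs_def
  have hs : 0 < s := ENNReal.toReal_pos hpos.ne' hfin.ne
  have hA : halfLine A = ENNReal.ofReal s := by
    rw [hs_def, ENNReal.ofReal_toReal hfin.ne, hΩ_def,
      (measurePreserving_areaRadius_sub w).measure_preimage hAm.nullMeasurableSet]
  -- Pulling back by the unitary shift keeps the family orthonormal and recentres Ω at the origin.
  set G : Fin n → FockSpace := fun k => (FockSpace.shift w).symm (F k) with hG_def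
  have hG : Orthonormal ℂ G := hF.comp_linearIsometryEquiv (FockSpace.shift w).symm
  have hFG : ∀ k, F k = FockSpace.shift w (G k) := fun k =>
    ((FockSpace.shift w).apply_symm_apply (F k)).symm
  have hint : ∑ k : Fin n, ∫ z in Ω, ‖F k z‖ ^ 2 * Real.exp (-(Real.pi * ‖z‖ ^ 2)) =
      ∑ k, ∫ z in areaRadius ⁻¹' A, ‖G k z‖ ^ 2 * fockWeight z :=
    Finset.sum_congr rfl fun k _ => by
      rw [hFG k]
      exact setIntegral_shift w (G k) hAm
  have hU : ∀ U : Matrix (Fin n) (Fin n) ℂ, (∀ z : ℂ, (fun k : Fin n => F k z) =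
      U *ᵥ (fun k : Fin n => FockSpace.shift w (FockSpace.monomial (k : ℕ)) z)) ↔
      ∀ k, G k = ∑ i : Fin n, U k i • FockSpace.monomial i := fun U => by
    have h1 : ∀ k, G k = ∑ i : Fin n, U k i • FockSpace.monomial i ↔
        F k = ∑ i : Fin n, U k i • FockSpace.shift w (FockSpace.monomial i) := fun k => by
      rw [hFG k, ← (FockSpace.shift w).injective.eq_iff, map_sum]
      simp only [map_smul]
    simp only [h1]
    constructor
    · intro h k
      refine FockSpace.ext fun z => ?_
      rw [FockSpace.sum_apply]
      exact congrFun (h z) k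
    · intro h z
      funext k
      rw [h k, FockSpace.sum_apply]
      rfl
  rw [hint, ← sum_poissonMass_Iic hs.le, sum_concentration_eq_iff hn hG hAm hs hA,
    ae_eq_ball_iff hAm hs hA w]
  simp only [hU, and_true]
  exact sum_concentration_le hn hG hAm hs hA
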